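/- Let $\mathcal M=(S,A,AP,L,I)$ be an interval Markov decision process: $S$, $A$, $AP$ are finite sets of states, actions and atomic propositions, $L:S\to 2^{AP}$ is a labelling, and $I$ assigns to each $(s,a,s')\in S\times A\times S$ a subinterval $I(s,a,s')$ of $[0,1]$. Write $s\xrightarrow{a}\mu$ if $\mu$ is a probability distribution on $S$ with $\mu(s')\in I(s,a,s')$ for every $s'\in S$; for all $s,a$ such a $\mu$ is assumed to exist. A scheduler $\sigma$ assigns to each finite path $\omega$ (a nonempty finite sequence of states) a probability distribution $\sigma(\omega)$ on $A$. A nature $\pi$ assigns to each finite path $\omega$ and action $a$ a distribution $\pi(\omega,a)$ with $\mathrm{last}(\omega)\xrightarrow{a}\pi(\omega,a)$. For a state $s$, let $\Pr_s^{\sigma,\pi}$ be the unique probability measure on infinite paths that starts in $s$ almost surely and for which, for every finite path $\omega$ and state $s'$, the probability of the set of paths with prefix $\omega s'$ equals the probability of the set of paths with prefix $\omega$ times $\sum_{a\in A}\sigma(\omega)(a)\,\pi(\omega,a)(s')$. PCTL state formulas $\varphi$ and path formulas $\psi$ are given by $$\varphi ::= \mathit{true}\mid x\mid\neg\varphi\mid\varphi_1\wedge\varphi_2\mid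 \mathsf P_{\bowtie p}(\psi),\qquad \psi ::= \mathsf X\varphi\mid \varphi_1\mathsf U\varphi_2\mid\varphi_1\mathsf U^{\le k}\varphi_2,$$ with $x\in AP$, $p\in[0,1]$ rational, ${\bowtie}\in\{\le,<,\ge,>\}$ and $k\ge 0$ an integer. The relation $s\models\varphi$ is defined as usual for $\mathit{true}$, atomic propositions (via $L$), negation and conjunction, and $$s\models\mathsf P_{\bowtie p}(\psi)\iff \text{there is a nature }\pi\text{ such that for all schedulers }\sigma:\ \Pr_s^{\sigma,\pi}[\{w : w\models\psi\}]\bowtie p .$$ For an infinite path $w=w_0w_1w_2\cdots$: $w\models\mathsf X\varphi$ iff $w_1\models\varphi$; $w\models\varphi_1\mathsf U^{\le k}\varphi_2$ iff there is $i\le k$ with $w_i\models\varphi_2$ and $w_j\models\varphi_1$ for all $0\le j<i$; and $w\models\varphi_1\mathsf U\varphi_2$ iff $w\models\varphi_1\mathsf U^{\le k}\varphi_2$ for some $k$. A symmetric relation $R\subseteq S\times S$ is a probabilistic $(\exists\pi\forall\sigma)$-bisimulation if for every $(s,t)\in R$ we have $L(s)=L(t)$, and for each family $(\mu_a)_{a\in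 A}$ with $s\xrightarrow{a}\mu_a$ for all $a$ there is a family $(\nu_a)_{a\in A}$ with $t\xrightarrow{a}\nu_a$ for all $a$ such that for each $\nu$ of the form $\nu=\sum_a\rho'(a)\nu_a$, $\rho'$ a probability distribution on $A$, there is $\mu$ of the form $\mu=\sum_a\rho(a)\mu_a$, $\rho$ a probability distribution on $A$, with $\mu(C)=\nu(C)$ for each class $C$ of the equivalence relation generated by $R$. States $s,t$ are bisimilar, $s\sim_{(\exists\pi\forall\sigma)}t$, if $(s,t)\in R$ for some such $R$. Theorem. If $s\sim_{(\exists\pi\forall\sigma)}t$, then for every PCTL state formula $\varphi$ we have $s\models\varphi$ if and only if $t\models\varphi$. -/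

import Mathlib

open MeasureTheory ProbabilityTheory

namespace IntervalMDP

/-- An interval Markov decision process with finite state set `S`, finite action set `A` and
atomic propositions `AP`. Every transition probability is constrained to a subinterval of `[0,1]`
(open, half-open or closed), and each state-action pair has some feasible distribution. -/
structure IMDP (S A AP : Type*) [Fintype S] where
  /-- the labelling function -/
  label : S → Set AP
  /-- the interval transition probability function -/
  interval : S → A → S → Set ℝ
  interval_ordConnected : ∀ s a s', (interval s a s').OrdConnected
  interval_subset : ∀ s a s', interval s a s' ⊆ Set.Icc 0 1
  feasible_nonempty : ∀ s a, ∃ μ ∈ stdSimplex ℝ S, ∀ s', μ s' ∈ interval s a s'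

/-- Finite paths with `n + 1` states, indexed by `0, …, n`. -/
abbrev FinPath (S : Type*) (n : ℕ) : Type _ := (i : Finset.Iic n) → (fun _ : ℕ => S) i

/-- The last state of a finite path. -/
def FinPath.last {S : Type*} {n : ℕ} (ω : FinPath S n) : S := ω ⟨n, Finset.mem_Iic.2 le_rfl⟩

/-- A scheduler assigns a distribution over actions to each finite path. -/
structure Scheduler (S A : Type*) [Fintype A] where
  choice : (n : ℕ) → FinPath S n → A → ℝ
  choice_mem : ∀ n ω, choice n ω ∈ stdSimplex ℝ A

section

variable {S A AP : Type*} [Fintype S]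

/-- The set of feasible distributions of the state `s` under the action `a`. -/
def IMDP.feasible (M : IMDP S A AP) (s : S) (a : A) : Set (S → ℝ) :=
  {μ | μ ∈ stdSimplex ℝ S ∧ ∀ s', μ s' ∈ M.interval s a s'}

/-- A nature assigns to each finite path and each action a feasible distribution of the last
state of the path under that action. -/
structure Nature (M : IMDP S A AP) where
  choice : (n : ℕ) → FinPath S n → A → S → ℝ
  choice_mem : ∀ n ω a, choice n ω a ∈ M.feasible ω.last a

/-- The discrete measure with weights `μ`. -/
noncomputable def weightMeasure [MeasurableSpace S] (μ : S → ℝ) : Measure S :=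
  ∑ x, ENNReal.ofReal (μ x) • Measure.dirac x

theorem isProbabilityMeasure_weightMeasure [MeasurableSpace S] {μ : S → ℝ}
    (hμ : μ ∈ stdSimplex ℝ S) : IsProbabilityMeasure (weightMeasure μ) := by
  constructor
  simp only [weightMeasure, Measure.coe_finsetSum, Finset.sum_apply, Measure.smul_apply,
    measure_univ, smul_eq_mul, mul_one]
  rw [← ENNReal.ofReal_sum_of_nonneg fun i _ => hμ.1 i, hμ.2, ENNReal.ofReal_one]

end

section

variable {S A AP : Type*} [Fintype S] [Fintype A]

/-- The weighted sum `∑ a, ρ a • μ a`: the successor distribution when the actions are drawn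
from `ρ` and the distribution `μ a` has been chosen for each action `a`. -/
def mix (ρ : A → ℝ) (μ : A → S → ℝ) (s' : S) : ℝ := ∑ a, ρ a * μ a s'

theorem mix_mem {ρ : A → ℝ} {μ : A → S → ℝ} (hρ : ρ ∈ stdSimplex ℝ A)
    (hμ : ∀ a, μ a ∈ stdSimplex ℝ S) : mix ρ μ ∈ stdSimplex ℝ S := by
  refine ⟨fun x => Finset.sum_nonneg fun a _ => mul_nonneg (hρ.1 a) ((hμ a).1 x), ?_⟩
  simp only [mix]
  rw [Finset.sum_comm]
  simp only [← Finset.mul_sum, (hμ _).2, mul_one, hρ.2]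

/-- The distribution of the next state after the finite path `ω`. -/
noncomputable def nextDist {M : IMDP S A AP} (σ : Scheduler S A) (π : Nature M)
    (n : ℕ) (ω : FinPath S n) : S → ℝ := mix (σ.choice n ω) (π.choice n ω)

theorem nextDist_mem {M : IMDP S A AP} (σ : Scheduler S A) (π : Nature M)
    (n : ℕ) (ω : FinPath S n) : nextDist σ π n ω ∈ stdSimplex ℝ S :=
  mix_mem (σ.choice_mem n ω) fun a => (π.choice_mem n ω a).1

variable [MeasurableSpace S] [DiscreteMeasurableSpace S]

/-- One step of the process, as a kernel from finite paths to states. -/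
noncomputable def stepKernel {M : IMDP S A AP} (σ : Scheduler S A) (π : Nature M) (n : ℕ) :
    Kernel (FinPath S n) ((fun _ : ℕ => S) (n + 1)) where
  toFun ω := weightMeasure (nextDist σ π n ω)
  measurable' := measurable_of_finite _

instance {M : IMDP S A AP} (σ : Scheduler S A) (π : Nature M) (n : ℕ) :
    IsMarkovKernel (stepKernel σ π n) :=
  ⟨fun ω => isProbabilityMeasure_weightMeasure (nextDist_mem σ π n ω)⟩

/-- The probability measure on infinite paths induced by the scheduler `σ` and the nature `π`
from the initial state `s` (constructed by the Ionescu-Tulcea theorem). -/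
noncomputable def pathMeasure {M : IMDP S A AP} (σ : Scheduler S A) (π : Nature M) (s : S) :
    Measure (ℕ → S) :=
  Kernel.traj (X := fun _ => S) (stepKernel σ π) 0 (fun _ => s)

theorem pathMeasure_eq_trajMeasure {M : IMDP S A AP} (σ : Scheduler S A) (π : Nature M) (s : S) :
    pathMeasure σ π s =
      Kernel.trajMeasure (X := fun _ => S) (Measure.dirac s) (stepKernel σ π) := by
  rw [Kernel.trajMeasure, Measure.map_dirac' (by fun_prop), Measure.dirac_bind (Kernel.measurable _)]
  rfl

/-- The path measure starts in `s`. -/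
theorem pathMeasure_start {M : IMDP S A AP} (σ : Scheduler S A) (π : Nature M) (s s' : S)
    [Decidable (s = s')] :
    pathMeasure σ π s {w | w 0 = s'} = if s = s' then 1 else 0 := by
  have h := congrArg (fun η => η {x : FinPath S 0 | x ⟨0, by simp⟩ = s'})
    (Kernel.traj_map_frestrictLe_apply (X := fun _ => S) (κ := stepKernel σ π) 0 0 (fun _ => s))
  rw [Kernel.partialTraj_self, Kernel.id_apply] at h
  rw [Measure.map_apply (by fun_prop) (Set.toFinite _).measurableSet,
    Measure.dirac_apply' _ (Set.toFinite _).measurableSet] at h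
  rw [pathMeasure]
  refine Eq.trans h ?_
  simp [Set.indicator_apply]

/-- The probability of traversing the path `ω` and then moving to `s'`. -/
theorem pathMeasure_step {M : IMDP S A AP} (σ : Scheduler S A) (π : Nature M) (s : S)
    (n : ℕ) (ω : FinPath S n) (s' : S) :
    pathMeasure σ π s {w | (∀ i : Finset.Iic n, w i = ω i) ∧ w (n + 1) = s'} =
      pathMeasure σ π s {w | ∀ i : Finset.Iic n, w i = ω i} *
        ENNReal.ofReal (∑ a, σ.choice n ω a * π.choice n ω a s') := by
  have h := congrArg (fun η => η ({ω} ×ˢ {s'}))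
    (Kernel.map_frestrictLe_trajMeasure_compProd_eq_map_trajMeasure (X := fun _ => S)
      (μ₀ := Measure.dirac s) (κ := stepKernel σ π) (a := n))
  rw [← pathMeasure_eq_trajMeasure] at h
  have h1 : MeasurableSet ({ω} : Set (FinPath S n)) := (Set.toFinite _).measurableSet
  have h2 : MeasurableSet ({s'} : Set S) := (Set.toFinite _).measurableSet
  have key : stepKernel σ π n ω {s'} =
      ENNReal.ofReal (∑ a, σ.choice n ω a * π.choice n ω a s') := by
    classical
    change weightMeasure (nextDist σ π n ω) {s'} = _
    simp [weightMeasure, nextDist, mix, Set.indicator_apply]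
  rw [Measure.compProd_apply_prod h1 h2, Measure.map_apply (by fun_prop) (h1.prod h2),
    Measure.restrict_singleton, lintegral_smul_measure, lintegral_dirac' _ (by fun_prop), key,
    Measure.map_apply (by fun_prop) h1] at h
  have e1 : {w : ℕ → S | ∀ i : Finset.Iic n, w i = ω i} =
      Preorder.frestrictLe (π := fun _ => S) n ⁻¹' {ω} := by
    ext w; simp [funext_iff]
  have e2 : {w : ℕ → S | (∀ i : Finset.Iic n, w i = ω i) ∧ w (n + 1) = s'} =
      (fun x : ℕ → S => (Preorder.frestrictLe (π := fun _ => S) n x, x (n + 1))) ⁻¹'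
        ({ω} ×ˢ {s'}) := by
    ext w; simp [funext_iff]
  rw [e1, e2]
  exact h.symm

end

/-- The comparison operators of PCTL. -/
inductive Comparison
  | le | lt | ge | gt

def Comparison.holds : Comparison → ℝ → ℝ → Prop
  | .le, x, y => x ≤ y
  | .lt, x, y => x < y
  | .ge, x, y => x ≥ y
  | .gt, x, y => x > y

/-- The two sorts of PCTL formulas. -/
inductive FormulaSort
  | state
  | path

/-- State formulas are interpreted in states, path formulas in infinite paths. -/
abbrev FormulaSort.Carrier (S : Type*) : FormulaSort → Type _
  | .state => S
  | .path => ℕ → S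

/-- PCTL formulas over the atomic propositions `AP`, of either sort. -/
inductive Formula (AP : Type*) : FormulaSort → Type _
  | tt : Formula AP .state
  | atom (x : AP) : Formula AP .state
  | neg (φ : Formula AP .state) : Formula AP .state
  | conj (φ₁ φ₂ : Formula AP .state) : Formula AP .state
  | prob (c : Comparison) (p : Set.Icc (0 : ℚ) 1) (ψ : Formula AP .path) : Formula AP .state
  | next (φ : Formula AP .state) : Formula AP .path
  | untl (φ₁ φ₂ : Formula AP .state) : Formula AP .path
  | untlLe (k : ℕ) (φ₁ φ₂ : Formula AP .state) : Formula AP .path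

abbrev StateFormula (AP : Type*) := Formula AP .state

abbrev PathFormula (AP : Type*) := Formula AP .path

section

variable {S A AP : Type*} [Fintype S] [Fintype A]

/-- The satisfaction relation in which the probabilistic operator is read as "there is a nature
such that for all schedulers". The states of an infinite path are `w 0, w 1, …`. -/
def IMDP.Sat [MeasurableSpace S] [DiscreteMeasurableSpace S] (M : IMDP S A AP) :
    {k : FormulaSort} → Formula AP k → k.Carrier S → Prop
  | _, .tt, _ => True
  | _, .atom x, s => x ∈ M.label s
  | _, .neg φ, s => ¬ M.Sat φ s
  | _, .conj φ₁ φ₂, s => M.Sat φ₁ s ∧ M.Sat φ₂ s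
  | _, .prob c p ψ, s => ∃ π : Nature M, ∀ σ : Scheduler S A,
      c.holds ((pathMeasure σ π s).real {w | M.Sat ψ w}) (p : ℚ)
  | _, .next φ, w => M.Sat φ (w 1)
  | _, .untl φ₁ φ₂, w => ∃ k : ℕ, ∃ i ≤ k, M.Sat φ₂ (w i) ∧ ∀ j < i, M.Sat φ₁ (w j)
  | _, .untlLe k φ₁ φ₂, w => ∃ i ≤ k, M.Sat φ₂ (w i) ∧ ∀ j < i, M.Sat φ₁ (w j)

/-- The mass that `μ` gives to the class `C` of the equivalence relation generated by `R`
(`Quot R` is the set of these classes). -/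
noncomputable def classMass (R : S → S → Prop) (μ : S → ℝ) (C : Quot R) : ℝ :=
  ∑ x, {x | Quot.mk R x = C}.indicator μ x

/-- Given a choice `μ a` of a distribution for each action `a`, the possible successor
distributions: those obtained from some decision of the scheduler. -/
def successors (μ : A → S → ℝ) : Set (S → ℝ) :=
  {ν | ∃ ρ ∈ stdSimplex ℝ A, ν = mix ρ μ}

/-- Probabilistic bisimulations for the semantics "there is a nature such that for all
schedulers". -/
structure IMDP.IsBisimulation (M : IMDP S A AP) (R : S → S → Prop) : Prop where
  symm : ∀ s t, R s t → R t s
  label_eq : ∀ s t, R s t → M.label s = M.label t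
  step : ∀ s t, R s t →
    ∀ μ : A → S → ℝ, (∀ a, μ a ∈ M.feasible s a) →
    ∃ ν : A → S → ℝ, (∀ a, ν a ∈ M.feasible t a) ∧
      ∀ ν' ∈ successors ν, ∃ μ' ∈ successors μ,
        ∀ C : Quot R, classMass R μ' C = classMass R ν' C

/-- Two states are bisimilar if some bisimulation relates them. -/
def IMDP.Bisimilar (M : IMDP S A AP) (s t : S) : Prop :=
  ∃ R : S → S → Prop, M.IsBisimulation R ∧ R s t

end

end IntervalMDP

set_option linter.unusedSectionVars false

/-! Histories from a fixed state are lists of later states, so a strategy splits into a first move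
and, for each next state, a residual strategy. The probability of a path formula then obeys a
recursion in these residuals. By induction on formulas the satisfaction sets of subformulas are
unions of classes. It remains to show that if nature can enforce a bound on a path formula from `s`,
it can do so from every `t` in the class of `s`.

For next and for bounded until this is a transfer along the recursion. A bisimulation gives, for the
first move at `s`, a first move at `t` all of whose mixtures agree on classes with mixtures of the
original. On reaching `y`, nature continues by imitating the residual strategy at the state of the
class of `y` that is best for nature. The resulting value is a class function, so expectations can
be compared. One induction (`exists_maxVal_le`) with reward `1` or `-1` covers upper and lower
bounds.

Unbounded until needs three arguments. For `≤` the same imitation works, because the supremum over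
schedulers is the limit of the finite-horizon maxima and an upper bound can be checked horizon by
horizon (`exists_supVal_le`).

For `<` the supremum over schedulers might equal `p` without being attained. If no strategy of
nature keeps the supremum below `p`, the value of the reachability game is at least `p`; discounting
shows that stationary schedulers approach this value, and as there are finitely many, one of them
guarantees `p` against every nature (`exists_sched_forall_ge`). This contradicts the assumed
strategy.

For `≥` and `>` a scheduler attains the infimum, so nature must match a least value. Step-by-step
imitation may fail here, since preserving the expected value at each step does not prevent the
process from circling forever without reaching the goal. The supremum of the least values over
natures is a class invariant by the finite-horizon case, so only an attained supremum is delicate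
(`exists_bestVal_le_infVal`). There nature averages replies to several optimal first moves, chosen
to leave every set that some optimal move leaves; a set trapping the average would trap all optimal
strategies and force their value to be zero. -/

namespace IntervalMDP

/-! ### Strategies as functions of lists, and their residuals -/

section Residual

variable {S A AP : Type*}

/-- The remainder of a strategy on lists of states, after the state `y` has been seen. -/
def after {β : Type*} (f : List S → β) (y : S) : List S → β := fun l => f (y :: l)

/-- Strategies of nature from the state `x`, as functions of the list of states visited
after `x`. -/
def IMDP.IsPlan [Fintype S] (M : IMDP S A AP) (x : S) (τ : List S → A → S → ℝ) : Prop :=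
  ∀ l a, τ l a ∈ M.feasible (l.getLastD x) a

theorem IMDP.IsPlan.head [Fintype S] {M : IMDP S A AP} {x : S} {τ : List S → A → S → ℝ}
    (h : M.IsPlan x τ) (a : A) : τ [] a ∈ M.feasible x a := h [] a

theorem IMDP.IsPlan.after [Fintype S] {M : IMDP S A AP} {x : S} {τ : List S → A → S → ℝ}
    (h : M.IsPlan x τ) (y : S) : M.IsPlan y (after τ y) := by
  intro l a
  have := h (y :: l) a
  rwa [List.getLastD_cons] at this

/-- The strategy that starts with `μ` and continues with `τ y` when the next state is `y`. -/
def consPlan {β : Type*} (μ : β) (τ : S → List S → β) : List S → β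
  | [] => μ
  | y :: l => τ y l

@[simp] theorem consPlan_nil {β : Type*} (μ : β) (τ : S → List S → β) : consPlan μ τ [] = μ := rfl

@[simp] theorem after_consPlan {β : Type*} (μ : β) (τ : S → List S → β) (y : S) :
    after (consPlan μ τ) y = τ y := rfl

theorem IMDP.isPlan_consPlan [Fintype S] {M : IMDP S A AP} {x : S} {μ : A → S → ℝ}
    {τ : S → List S → A → S → ℝ}
    (hμ : ∀ a, μ a ∈ M.feasible x a) (hτ : ∀ y, M.IsPlan y (τ y)) :
    M.IsPlan x (consPlan μ τ) := by
  intro l a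
  cases l with
  | nil => exact hμ a
  | cons y l => rw [List.getLastD_cons]; exact hτ y l a

theorem IMDP.exists_isPlan [Fintype S] (M : IMDP S A AP) (x : S) : ∃ τ, M.IsPlan x τ := by
  choose f hf using M.feasible_nonempty
  exact ⟨fun l a => f (l.getLastD x) a, fun l a => hf _ a⟩

/-- Strategies of the scheduler, as functions of the list of states visited so far. -/
def IsSched [Fintype A] (σ : List S → A → ℝ) : Prop := ∀ l, σ l ∈ stdSimplex ℝ A

theorem IsSched.after [Fintype A] {σ : List S → A → ℝ} (h : IsSched σ) (y : S) :
    IsSched (after σ y) := fun l => h (y :: l)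

theorem isSched_consPlan [Fintype A] {ρ : A → ℝ} {σ : S → List S → A → ℝ}
    (hρ : ρ ∈ stdSimplex ℝ A) (hσ : ∀ y, IsSched (σ y)) : IsSched (consPlan ρ σ) := by
  intro l
  cases l with
  | nil => exact hρ
  | cons y l => exact hσ y l

open scoped Classical in
/-- The probability of reaching `g` within `k` steps while staying in `b`. -/
noncomputable def untilProb [Fintype S] [Fintype A] (b g : S → Prop) :
    ℕ → S → (List S → A → ℝ) → (List S → A → S → ℝ) → ℝ
  | 0, x, _, _ => if g x then 1 else 0
  | k + 1, x, σ, τ => if g x then 1 else if b x then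
      ∑ y, mix (σ []) (τ []) y * untilProb b g k y (after σ y) (after τ y) else 0

end Residual

/-! ### Elementary properties of bounded until probabilities -/

section Until

variable {S A AP : Type*} [Fintype S] [Fintype A] {M : IMDP S A AP} {b g : S → Prop}

theorem untilProb_of_goal {k : ℕ} {x : S} {σ : List S → A → ℝ} {τ : List S → A → S → ℝ}
    (hg : g x) : untilProb b g k x σ τ = 1 := by
  cases k <;> simp [untilProb, hg]

theorem untilProb_of_not {k : ℕ} {x : S} {σ : List S → A → ℝ} {τ : List S → A → S → ℝ}
    (hg : ¬ g x) (hb : ¬ b x) : untilProb b g k x σ τ = 0 := by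
  cases k <;> simp [untilProb, hg, hb]

theorem untilProb_succ {k : ℕ} {x : S} {σ : List S → A → ℝ} {τ : List S → A → S → ℝ}
    (hg : ¬ g x) (hb : b x) : untilProb b g (k + 1) x σ τ =
      ∑ y, mix (σ []) (τ []) y * untilProb b g k y (after σ y) (after τ y) := by
  simp [untilProb, hg, hb]

theorem mix_head_mem {x : S} {σ : List S → A → ℝ} {τ : List S → A → S → ℝ}
    (hσ : IsSched σ) (hτ : M.IsPlan x τ) : mix (σ []) (τ []) ∈ stdSimplex ℝ S :=
  mix_mem (hσ []) fun a => (hτ.head a).1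

theorem untilProb_nonneg (k : ℕ) {x : S} {σ : List S → A → ℝ} {τ : List S → A → S → ℝ}
    (hσ : IsSched σ) (hτ : M.IsPlan x τ) : 0 ≤ untilProb b g k x σ τ := by
  induction k generalizing x σ τ with
  | zero => unfold untilProb; split_ifs <;> norm_num
  | succ k ih =>
    unfold untilProb
    split_ifs
    · norm_num
    · exact Finset.sum_nonneg fun y _ =>
        mul_nonneg ((mix_head_mem hσ hτ).1 y) (ih (hσ.after y) (hτ.after y))
    · rfl

theorem sum_mul_le_of_le {μ f : S → ℝ} (hμ : μ ∈ stdSimplex ℝ S) {r : ℝ} (hf : ∀ y, f y ≤ r) :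
    ∑ y, μ y * f y ≤ r := by
  calc ∑ y, μ y * f y ≤ ∑ y, μ y * r :=
        Finset.sum_le_sum fun y _ => mul_le_mul_of_nonneg_left (hf y) (hμ.1 y)
    _ = r := by rw [← Finset.sum_mul, hμ.2, one_mul]

theorem sum_mul_mono {μ f f' : S → ℝ} (hμ : μ ∈ stdSimplex ℝ S) (hf : ∀ y, f y ≤ f' y) :
    ∑ y, μ y * f y ≤ ∑ y, μ y * f' y :=
  Finset.sum_le_sum fun y _ => mul_le_mul_of_nonneg_left (hf y) (hμ.1 y)

theorem untilProb_le_one (k : ℕ) {x : S} {σ : List S → A → ℝ} {τ : List S → A → S → ℝ}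
    (hσ : IsSched σ) (hτ : M.IsPlan x τ) : untilProb b g k x σ τ ≤ 1 := by
  induction k generalizing x σ τ with
  | zero => unfold untilProb; split_ifs <;> norm_num
  | succ k ih =>
    unfold untilProb
    split_ifs
    · rfl
    · exact sum_mul_le_of_le (mix_head_mem hσ hτ) fun y => ih (hσ.after y) (hτ.after y)
    · norm_num

end Until

/-! ### The path measure expressed through the recursive probabilities -/

section Connection

variable {S A AP : Type*} [Fintype S] [Fintype A] {M : IMDP S A AP}

/-- The finite path that starts in `s` and continues with the list `l`. -/
def pathOf (s : S) (l : List S) : FinPath S l.length := fun i => (s :: l).getD i s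

/-- The list of states of a finite path after the first one. -/
def listOf {n : ℕ} (ω : FinPath S n) : List S :=
  List.ofFn fun i : Fin n => ω ⟨i + 1, Finset.mem_Iic.2 i.2⟩

theorem listOf_pathOf (s : S) (l : List S) : listOf (pathOf s l) = l := by
  apply List.ext_getElem
  · simp [listOf]
  · intro i h1 h2
    simp [listOf, pathOf]

theorem getLastD_listOf {n : ℕ} (ω : FinPath S n) :
    (listOf ω).getLastD (ω ⟨0, Finset.mem_Iic.2 n.zero_le⟩) = ω.last := by
  cases n with
  | zero => rfl
  | succ n =>
    have : listOf ω ≠ [] := by simp [listOf]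
    rw [List.getLastD_eq_getLast?, List.getLast?_eq_getLast_of_ne_nil this, Option.getD_some,
      List.getLast_eq_getElem]
    simp only [listOf, List.getElem_ofFn, List.length_ofFn, Nat.add_sub_cancel]
    rfl

theorem pathOf_last (s : S) (l : List S) : (pathOf s l).last = l.getLastD s := by
  rw [← getLastD_listOf, listOf_pathOf]
  rfl

/-- The strategy on lists induced by a scheduler from the state `s`. -/
def Scheduler.residual (σ : Scheduler S A) (s : S) : List S → A → ℝ :=
  fun l => σ.choice l.length (pathOf s l)

/-- The strategy on lists induced by a nature from the state `s`. -/
def Nature.residual (π : Nature M) (s : S) : List S → A → S → ℝ :=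
  fun l => π.choice l.length (pathOf s l)

theorem Scheduler.isSched_residual (σ : Scheduler S A) (s : S) : IsSched (σ.residual s) :=
  fun _ => σ.choice_mem _ _

theorem Nature.isPlan_residual (π : Nature M) (s : S) : M.IsPlan s (π.residual s) := by
  intro l a
  have := π.choice_mem _ (pathOf s l) a
  rwa [pathOf_last] at this

theorem Scheduler.exists_residual_eq {σ : List S → A → ℝ} (hσ : IsSched σ) (s : S) :
    ∃ σ' : Scheduler S A, σ'.residual s = σ :=
  ⟨⟨fun _ ω => σ (listOf ω), fun _ _ => hσ _⟩, funext fun l => by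
    simp [Scheduler.residual, listOf_pathOf]⟩

theorem Nature.exists_residual_eq {s : S} {τ : List S → A → S → ℝ} (hτ : M.IsPlan s τ) :
    ∃ π : Nature M, π.residual s = τ := by
  classical
  choose d hd using M.exists_isPlan
  -- `τ` is feasible only on histories starting in `s`; histories with another first state get an
  -- arbitrary feasible plan.
  let τ' : S → List S → A → S → ℝ := fun x => if x = s then τ else d x
  have hτ' : ∀ x, M.IsPlan x (τ' x) := by
    intro x
    by_cases h : x = s
    · subst h; simpa [τ'] using hτ
    · simpa [τ', h] using hd x
  refine ⟨⟨fun n ω => τ' (ω ⟨0, Finset.mem_Iic.2 n.zero_le⟩) (listOf ω), fun n ω a => ?_⟩, ?_⟩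
  · rw [← getLastD_listOf]
    exact hτ' _ _ _
  · funext l
    simp [Nature.residual, listOf_pathOf, pathOf, τ']

variable [MeasurableSpace S] [DiscreteMeasurableSpace S]

/-- The infinite paths with prefix `s :: l`. -/
def cyl (s : S) (l : List S) : Set (ℕ → S) := {w | ∀ i : Finset.Iic l.length, w i = pathOf s l i}

theorem mem_cyl_concat {s : S} {l : List S} {y : S} {w : ℕ → S} :
    w ∈ cyl s (l ++ [y]) ↔ w ∈ cyl s l ∧ w (l.length + 1) = y := by
  have e : ∀ i ≤ l.length, (s :: (l ++ [y])).getD i s = (s :: l).getD i s := by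
    intro i hi
    rw [← List.cons_append, List.getD_append _ _ _ _ (by simpa using Nat.lt_succ_of_le hi)]
  have e' : (s :: (l ++ [y])).getD (l.length + 1) s = y := by simp
  simp only [cyl, Set.mem_ofPred_eq, pathOf, Subtype.forall, Finset.mem_Iic, List.length_append,
    List.length_singleton]
  constructor
  · intro h
    refine ⟨fun i hi => (h i (by omega)).trans (e i hi), (h _ le_rfl).trans e'⟩
  · rintro ⟨h, h'⟩ i hi
    rcases Nat.lt_or_ge l.length i with hl | hl
    · obtain rfl : i = l.length + 1 := by omega
      rw [h', e']
    · rw [h i hl, e i hl]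

theorem apply_length_of_mem_cyl {s : S} {l : List S} {w : ℕ → S} (h : w ∈ cyl s l) :
    w l.length = l.getLastD s := by
  rw [← pathOf_last]
  exact h ⟨l.length, Finset.mem_Iic.2 le_rfl⟩

theorem pathMeasure_cyl_concat (σ : Scheduler S A) (π : Nature M) (s : S) (l : List S) (y : S) :
    pathMeasure σ π s (cyl s (l ++ [y])) = pathMeasure σ π s (cyl s l) *
      ENNReal.ofReal (mix (σ.residual s l) (π.residual s l) y) := by
  rw [show cyl s (l ++ [y]) = {w | w ∈ cyl s l ∧ w (l.length + 1) = y} from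
    Set.ext fun w => mem_cyl_concat]
  exact pathMeasure_step σ π s l.length (pathOf s l) y

theorem pathMeasure_cyl_nil (σ : Scheduler S A) (π : Nature M) (s : S) :
    pathMeasure σ π s (cyl s []) = 1 := by
  classical
  have h := pathMeasure_start σ π s s
  rw [if_pos rfl] at h
  rw [← h]
  congr 1
  ext w
  simp [cyl, pathOf]

instance (σ : Scheduler S A) (π : Nature M) (s : S) :
    IsProbabilityMeasure (pathMeasure σ π s) := by
  unfold pathMeasure; infer_instance

/-- `E` need not be measurable, because the restriction of `μ` to `E` is evaluated only on
measurable level sets of a coordinate. -/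
theorem measure_eq_sum_inter (μ : Measure (ℕ → S)) (E : Set (ℕ → S)) (n : ℕ) :
    μ E = ∑ y, μ (E ∩ {w | w n = y}) := by
  have hm : ∀ y ∈ (Finset.univ : Finset S), MeasurableSet ((fun w : ℕ → S => w n) ⁻¹' {y}) :=
    fun y _ => (measurable_pi_apply n) (MeasurableSet.of_discrete)
  have h := sum_measure_preimage_singleton (μ := μ.restrict E) Finset.univ hm
  simp only [Finset.coe_univ, Set.preimage_univ, Measure.restrict_apply MeasurableSet.univ,
    Set.univ_inter] at h
  rw [← h]
  refine Finset.sum_congr rfl fun y hy => ?_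
  rw [Measure.restrict_apply (hm y hy), Set.inter_comm]
  rfl

theorem getLastD_append (l l' : List S) (s : S) :
    (l ++ l').getLastD s = l'.getLastD (l.getLastD s) := by
  induction l generalizing s with
  | nil => rfl
  | cons y l ih => rw [List.cons_append, List.getLastD_cons, List.getLastD_cons, ih]

/-- After the prefix `l` the process is governed by the residual strategies. Splitting the cylinder
by the next state reproduces the recursion of `untilProb`, so the prefix has to vary in the
induction on `k`. -/
theorem pathMeasure_cyl_until (b g : S → Prop) (σ : Scheduler S A) (π : Nature M) (s : S) (k : ℕ)
    (l : List S) :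
    pathMeasure σ π s (cyl s l ∩
        {w | ∃ i ≤ k, g (w (l.length + i)) ∧ ∀ j < i, b (w (l.length + j))}) =
      pathMeasure σ π s (cyl s l) * ENNReal.ofReal (untilProb b g k (l.getLastD s)
        (fun l' => σ.residual s (l ++ l')) (fun l' => π.residual s (l ++ l'))) := by
  have hpos : ∀ l, IsSched (fun l' => σ.residual s (l ++ l')) :=
    fun l l' => σ.isSched_residual s (l ++ l')
  have hplan : ∀ l, M.IsPlan (l.getLastD s) (fun l' => π.residual s (l ++ l')) := by
    intro l l' a
    have := π.isPlan_residual s (l ++ l') a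
    rwa [getLastD_append] at this
  have hgoal : ∀ (k : ℕ) (l : List S), g (l.getLastD s) → cyl s l ∩
      {w | ∃ i ≤ k, g (w (l.length + i)) ∧ ∀ j < i, b (w (l.length + j))} = cyl s l := by
    intro k l hg
    refine Set.inter_eq_left.2 fun w hw => ⟨0, Nat.zero_le _, ?_, by simp⟩
    rw [add_zero, apply_length_of_mem_cyl hw]; exact hg
  induction k generalizing l with
  | zero =>
    by_cases hg : g (l.getLastD s)
    · rw [hgoal 0 l hg, untilProb_of_goal hg, ENNReal.ofReal_one, mul_one]
    · rw [show untilProb b g 0 (l.getLastD s) _ _ = 0 by simp only [untilProb, hg, if_false]]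
      rw [ENNReal.ofReal_zero, mul_zero]
      convert measure_empty (μ := pathMeasure σ π s)
      refine Set.eq_empty_of_forall_notMem ?_
      rintro w ⟨hw, i, hi, h1, -⟩
      obtain rfl : i = 0 := by omega
      rw [add_zero, apply_length_of_mem_cyl hw] at h1
      exact hg h1
  | succ k ih =>
    by_cases hg : g (l.getLastD s)
    · rw [hgoal _ l hg, untilProb_of_goal hg, ENNReal.ofReal_one, mul_one]
    by_cases hb : b (l.getLastD s)
    · rw [untilProb_succ hg hb, measure_eq_sum_inter _ _ (l.length + 1),
        ENNReal.ofReal_sum_of_nonneg fun y _ => mul_nonneg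
          ((mix_head_mem (hpos l) (hplan l)).1 y)
          (untilProb_nonneg k ((hpos l).after y) ((hplan l).after y)), Finset.mul_sum]
      refine Finset.sum_congr rfl fun y _ => ?_
      rw [ENNReal.ofReal_mul ((mix_head_mem (hpos l) (hplan l)).1 y), ← mul_assoc]
      simp only [List.append_nil]
      rw [← pathMeasure_cyl_concat]
      have h := ih (l ++ [y])
      rw [List.getLastD_concat] at h
      simp only [List.append_assoc, List.singleton_append] at h
      refine Eq.trans ?_ h
      congr 1
      ext w
      simp only [Set.mem_inter_iff, mem_cyl_concat, Set.mem_ofPred_eq, List.length_append,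
        List.length_singleton]
      constructor
      · rintro ⟨⟨hw, i, hi, h1, h2⟩, hy⟩
        refine ⟨⟨hw, hy⟩, ?_⟩
        cases i with
        | zero => rw [add_zero, apply_length_of_mem_cyl hw] at h1; exact absurd h1 hg
        | succ i =>
          refine ⟨i, by omega, by rwa [add_assoc, add_comm 1], fun j hj => ?_⟩
          rw [add_assoc, add_comm 1]; exact h2 _ (by omega)
      · rintro ⟨⟨hw, hy⟩, i, hi, h1, h2⟩
        refine ⟨⟨hw, i + 1, by omega, by rwa [add_assoc, add_comm 1] at h1, fun j hj => ?_⟩, hy⟩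
        cases j with
        | zero => rw [add_zero, apply_length_of_mem_cyl hw]; exact hb
        | succ j => have := h2 j (by omega); rwa [add_assoc, add_comm 1] at this
    · rw [untilProb_of_not hg hb, ENNReal.ofReal_zero, mul_zero]
      convert measure_empty (μ := pathMeasure σ π s)
      refine Set.eq_empty_of_forall_notMem ?_
      rintro w ⟨hw, i, hi, h1, h2⟩
      cases i with
      | zero => rw [add_zero, apply_length_of_mem_cyl hw] at h1; exact hg h1
      | succ i =>
        have := h2 0 (by omega)
        rw [add_zero, apply_length_of_mem_cyl hw] at this; exact hb this

theorem pathMeasure_cyl_nil_inter (σ : Scheduler S A) (π : Nature M) (s : S)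
    (E : Set (ℕ → S)) : pathMeasure σ π s (cyl s [] ∩ E) = pathMeasure σ π s E := by
  have hm : MeasurableSet (cyl s []) := by
    have : cyl s [] = (fun w : ℕ → S => w 0) ⁻¹' {s} := by ext w; simp [cyl, pathOf]
    rw [this]
    exact (measurable_pi_apply 0) MeasurableSet.of_discrete
  rw [Set.inter_comm]
  exact measure_inter_conull ((prob_compl_eq_zero_iff hm).2 (pathMeasure_cyl_nil σ π s))

theorem pathMeasure_real_untilLe (b g : S → Prop) (σ : Scheduler S A) (π : Nature M) (s : S)
    (k : ℕ) :
    (pathMeasure σ π s).real {w | ∃ i ≤ k, g (w i) ∧ ∀ j < i, b (w j)} =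
      untilProb b g k s (σ.residual s) (π.residual s) := by
  have h := pathMeasure_cyl_until b g σ π s k []
  rw [pathMeasure_cyl_nil, one_mul, pathMeasure_cyl_nil_inter] at h
  simp only [List.length_nil, zero_add, List.nil_append, List.getLastD_nil] at h
  rw [measureReal_def, h, ENNReal.toReal_ofReal]
  exact untilProb_nonneg k (σ.isSched_residual s) (π.isPlan_residual s)

/-- The event is the increasing union of the bounded until events, so continuity from below applies.
-/
theorem pathMeasure_real_until (b g : S → Prop) (σ : Scheduler S A) (π : Nature M) (s : S) :
    (pathMeasure σ π s).real {w | ∃ k : ℕ, ∃ i ≤ k, g (w i) ∧ ∀ j < i, b (w j)} =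
      ⨆ k, untilProb b g k s (σ.residual s) (π.residual s) := by
  have hmono : Monotone fun k : ℕ => {w : ℕ → S | ∃ i ≤ k, g (w i) ∧ ∀ j < i, b (w j)} :=
    fun k k' hk w ⟨i, hi, h⟩ => ⟨i, hi.trans hk, h⟩
  have h1 := tendsto_measure_iUnion_atTop (μ := pathMeasure σ π s) hmono
  have h2 := (ENNReal.tendsto_toReal (measure_ne_top _ _)).comp h1
  have e : ∀ k, ((pathMeasure σ π s) {w : ℕ → S | ∃ i ≤ k, g (w i) ∧ ∀ j < i, b (w j)}).toReal =
      untilProb b g k s (σ.residual s) (π.residual s) :=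
    fun k => pathMeasure_real_untilLe b g σ π s k
  have h3 : Monotone fun k => untilProb b g k s (σ.residual s) (π.residual s) := by
    intro k k' hk
    simp only [← e]
    exact ENNReal.toReal_mono (measure_ne_top _ _) (measure_mono (hmono hk))
  have h4 := tendsto_atTop_ciSup h3 ⟨1, by
    rintro _ ⟨k, rfl⟩
    exact untilProb_le_one k (σ.isSched_residual s) (π.isPlan_residual s)⟩
  have h5 : Set.iUnion (fun k : ℕ => {w : ℕ → S | ∃ i ≤ k, g (w i) ∧ ∀ j < i, b (w j)}) =
      {w | ∃ k : ℕ, ∃ i ≤ k, g (w i) ∧ ∀ j < i, b (w j)} := by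
    ext w; simp
  rw [h5] at h2
  refine tendsto_nhds_unique (h2.congr fun k => ?_) h4
  exact e k

theorem pathMeasure_real_next (g : S → Prop) [DecidablePred g] (σ : Scheduler S A) (π : Nature M)
    (s : S) :
    (pathMeasure σ π s).real {w | g (w 1)} =
      ∑ y, mix (σ.residual s []) (π.residual s []) y * if g y then 1 else 0 := by
  have hn := (mix_head_mem (σ.isSched_residual s) (π.isPlan_residual s)).1
  have hc : ∀ y, pathMeasure σ π s {w | w 1 = y} =
      ENNReal.ofReal (mix (σ.residual s []) (π.residual s []) y) := by
    intro y
    have h := pathMeasure_cyl_concat σ π s [] y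
    rw [pathMeasure_cyl_nil, one_mul] at h
    rw [← h, ← pathMeasure_cyl_nil_inter]
    congr 1
    ext w
    rw [mem_cyl_concat]
    rfl
  rw [measureReal_def, measure_eq_sum_inter _ _ 1, ENNReal.toReal_sum fun _ _ => measure_ne_top _ _]
  refine Finset.sum_congr rfl fun y _ => ?_
  split_ifs with h
  · rw [show {w : ℕ → S | g (w 1)} ∩ {w | w 1 = y} = {w | w 1 = y} from
      Set.inter_eq_right.2 fun w hw => by
        have hw' : w 1 = y := hw
        change g (w 1)
        rwa [hw'], hc, ENNReal.toReal_ofReal (hn y), mul_one]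
  · rw [show {w : ℕ → S | g (w 1)} ∩ {w | w 1 = y} = ∅ from
      Set.eq_empty_of_forall_notMem fun w hw => by
        have hw' : w 1 = y := hw.2
        exact h (hw' ▸ hw.1)]
    simp

end Connection

/-! ### Optimal values of the scheduler against a fixed nature -/

section Value

open Filter Topology

variable {S A AP : Type*} [Fintype S] [Fintype A] {M : IMDP S A AP} {b g : S → Prop}

theorem untilProb_le_succ (k : ℕ) {x : S} {σ : List S → A → ℝ} {τ : List S → A → S → ℝ}
    (hσ : IsSched σ) (hτ : M.IsPlan x τ) :
    untilProb b g k x σ τ ≤ untilProb b g (k + 1) x σ τ := by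
  induction k generalizing x σ τ with
  | zero =>
    by_cases hg : g x
    · rw [untilProb_of_goal hg, untilProb_of_goal hg]
    · rw [untilProb, if_neg hg]
      exact untilProb_nonneg _ hσ hτ
  | succ k ih =>
    by_cases hg : g x
    · rw [untilProb_of_goal hg, untilProb_of_goal hg]
    by_cases hb : b x
    · rw [untilProb_succ hg hb, untilProb_succ hg hb]
      exact sum_mul_mono (mix_head_mem hσ hτ) fun y => ih (hσ.after y) (hτ.after y)
    · rw [untilProb_of_not hg hb, untilProb_of_not hg hb]

theorem bddAbove_untilProb {x : S} {σ : List S → A → ℝ} {τ : List S → A → S → ℝ}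
    (hσ : IsSched σ) (hτ : M.IsPlan x τ) :
    BddAbove (Set.range fun k => untilProb b g k x σ τ) :=
  ⟨1, by rintro _ ⟨k, rfl⟩; exact untilProb_le_one k hσ hτ⟩

theorem sum_mix_mul (ρ : A → ℝ) (μ : A → S → ℝ) (f : S → ℝ) :
    ∑ y, mix ρ μ y * f y = ∑ a, ρ a * ∑ y, μ a y * f y := by
  simp only [mix, Finset.sum_mul, Finset.mul_sum, mul_assoc]
  exact Finset.sum_comm

theorem mix_single [DecidableEq A] (a : A) (μ : A → S → ℝ) : mix (Pi.single a 1) μ = μ a := by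
  funext y
  simp [mix, Pi.single_apply]

open scoped Classical in
/-- The best expected reward of a scheduler that receives the reward `c` when `g` is reached
within `k` steps while staying in `b`. -/
noncomputable def maxVal (c : ℝ) (b g : S → Prop) :
    ℕ → S → (List S → A → S → ℝ) → ℝ
  | 0, x, _ => if g x then c else 0
  | k + 1, x, τ => if g x then c else if b x then
      ⨆ a, ∑ y, τ [] a y * maxVal c b g k y (after τ y) else 0

variable {c : ℝ}

theorem maxVal_of_goal {k : ℕ} {x : S} {τ : List S → A → S → ℝ} (hg : g x) :
    maxVal c b g k x τ = c := by
  cases k <;> simp [maxVal, hg]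

theorem maxVal_of_not {k : ℕ} {x : S} {τ : List S → A → S → ℝ} (hg : ¬ g x) (hb : ¬ b x) :
    maxVal c b g k x τ = 0 := by
  cases k <;> simp [maxVal, hg, hb]

theorem maxVal_zero_of_not {x : S} {τ : List S → A → S → ℝ} (hg : ¬ g x) :
    maxVal c b g 0 x τ = 0 := by
  simp [maxVal, hg]

theorem maxVal_zero_congr {x y : S} {τ τ' : List S → A → S → ℝ} (h : g x ↔ g y) :
    maxVal c b g 0 y τ' = maxVal c b g 0 x τ := by
  by_cases hg : g x
  · rw [maxVal_of_goal hg, maxVal_of_goal (h.1 hg)]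
  · rw [maxVal_zero_of_not hg, maxVal_zero_of_not (mt h.2 hg)]

theorem maxVal_succ {k : ℕ} {x : S} {τ : List S → A → S → ℝ} (hg : ¬ g x) (hb : b x) :
    maxVal c b g (k + 1) x τ = ⨆ a, ∑ y, τ [] a y * maxVal c b g k y (after τ y) := by
  simp [maxVal, hg, hb]

theorem sum_le_maxVal_succ {k : ℕ} {x : S} {τ : List S → A → S → ℝ} (hg : ¬ g x) (hb : b x)
    (a : A) : ∑ y, τ [] a y * maxVal c b g k y (after τ y) ≤ maxVal c b g (k + 1) x τ := by
  rw [maxVal_succ hg hb]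
  exact le_ciSup (f := fun a => ∑ y, τ [] a y * maxVal c b g k y (after τ y))
    (Set.finite_range _).bddAbove a

theorem exists_maxVal_succ_eq [Nonempty A] {k : ℕ} {x : S} {τ : List S → A → S → ℝ}
    (hg : ¬ g x) (hb : b x) :
    ∃ a, ∑ y, τ [] a y * maxVal c b g k y (after τ y) = maxVal c b g (k + 1) x τ := by
  rw [maxVal_succ hg hb]
  exact exists_eq_ciSup_of_finite

/-- Randomising over actions never beats the best action. The sign of `c` is free: `c = -1` turns
this into a lower bound on the probability. -/
theorem mul_untilProb_le_maxVal (k : ℕ) {x : S} {σ : List S → A → ℝ} {τ : List S → A → S → ℝ}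
    (hσ : IsSched σ) (hτ : M.IsPlan x τ) :
    c * untilProb b g k x σ τ ≤ maxVal c b g k x τ := by
  induction k generalizing x σ τ with
  | zero => unfold untilProb maxVal; split_ifs <;> simp
  | succ k ih =>
    by_cases hg : g x
    · rw [untilProb_of_goal hg, maxVal_of_goal hg, mul_one]
    by_cases hb : b x
    · rw [untilProb_succ hg hb, Finset.mul_sum]
      calc ∑ y, c * (mix (σ []) (τ []) y * untilProb b g k y (after σ y) (after τ y))
          = ∑ y, mix (σ []) (τ []) y * (c * untilProb b g k y (after σ y) (after τ y)) :=
            Finset.sum_congr rfl fun y _ => by ring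
        _ ≤ ∑ y, mix (σ []) (τ []) y * maxVal c b g k y (after τ y) :=
            sum_mul_mono (mix_head_mem hσ hτ) fun y => ih (hσ.after y) (hτ.after y)
        _ ≤ _ := by
            rw [sum_mix_mul]
            exact sum_mul_le_of_le (hσ []) fun a => sum_le_maxVal_succ hg hb a
    · rw [untilProb_of_not hg hb, maxVal_of_not hg hb, mul_zero]

theorem exists_mul_untilProb_eq_maxVal [Nonempty A] (c : ℝ) (b g : S → Prop) (k : ℕ) (x : S)
    (τ : List S → A → S → ℝ) :
    ∃ σ, IsSched σ ∧ c * untilProb b g k x σ τ = maxVal c b g k x τ := by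
  classical
  induction k generalizing x τ with
  | zero =>
    refine ⟨fun _ => Pi.single (Classical.arbitrary A) 1, fun _ => single_mem_stdSimplex _ _, ?_⟩
    unfold untilProb maxVal; split_ifs <;> simp
  | succ k ih =>
    choose σ hσ h using fun y => ih y (after τ y)
    by_cases hg : g x
    · exact ⟨_, hσ x, by rw [untilProb_of_goal hg, maxVal_of_goal hg, mul_one]⟩
    by_cases hb : b x
    · obtain ⟨a, ha⟩ := exists_maxVal_succ_eq (c := c) (k := k) (τ := τ) hg hb
      refine ⟨consPlan (Pi.single a 1) σ, isSched_consPlan (single_mem_stdSimplex _ _) hσ, ?_⟩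
      rw [untilProb_succ hg hb, ← ha, consPlan_nil, mix_single, Finset.mul_sum]
      refine Finset.sum_congr rfl fun y _ => ?_
      rw [after_consPlan, ← h]
      ring
    · exact ⟨_, hσ x, by rw [untilProb_of_not hg hb, maxVal_of_not hg hb, mul_zero]⟩

/-- The least probability of reaching `g` within `k` steps while staying in `b`. -/
noncomputable def minVal (b g : S → Prop) (k : ℕ) (x : S) (τ : List S → A → S → ℝ) : ℝ :=
  -maxVal (-1) b g k x τ

theorem minVal_le_untilProb (k : ℕ) {x : S} {σ : List S → A → ℝ} {τ : List S → A → S → ℝ}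
    (hσ : IsSched σ) (hτ : M.IsPlan x τ) : minVal b g k x τ ≤ untilProb b g k x σ τ := by
  have := mul_untilProb_le_maxVal (c := -1) (b := b) (g := g) k hσ hτ
  unfold minVal
  linarith

theorem exists_untilProb_eq_minVal [Nonempty A] (b g : S → Prop) (k : ℕ) (x : S)
    (τ : List S → A → S → ℝ) : ∃ σ, IsSched σ ∧ untilProb b g k x σ τ = minVal b g k x τ := by
  obtain ⟨σ, hσ, h⟩ := exists_mul_untilProb_eq_maxVal (-1) b g k x τ
  exact ⟨σ, hσ, by unfold minVal; linarith⟩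

theorem untilProb_le_maxVal (k : ℕ) {x : S} {σ : List S → A → ℝ} {τ : List S → A → S → ℝ}
    (hσ : IsSched σ) (hτ : M.IsPlan x τ) : untilProb b g k x σ τ ≤ maxVal 1 b g k x τ := by
  simpa using mul_untilProb_le_maxVal (c := 1) (b := b) (g := g) k hσ hτ

theorem exists_untilProb_eq_maxVal [Nonempty A] (b g : S → Prop) (k : ℕ) (x : S)
    (τ : List S → A → S → ℝ) : ∃ σ, IsSched σ ∧ untilProb b g k x σ τ = maxVal 1 b g k x τ := by
  simpa using exists_mul_untilProb_eq_maxVal 1 b g k x τ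

theorem minVal_succ_le {k : ℕ} {x : S} {τ : List S → A → S → ℝ} (hg : ¬ g x) (hb : b x)
    (a : A) : minVal b g (k + 1) x τ ≤ ∑ y, τ [] a y * minVal b g k y (after τ y) := by
  have := sum_le_maxVal_succ (c := -1) (k := k) (τ := τ) hg hb a
  simp only [minVal, mul_neg, Finset.sum_neg_distrib]
  linarith

theorem exists_minVal_succ_eq [Nonempty A] {k : ℕ} {x : S} {τ : List S → A → S → ℝ}
    (hg : ¬ g x) (hb : b x) :
    ∃ a, ∑ y, τ [] a y * minVal b g k y (after τ y) = minVal b g (k + 1) x τ := by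
  obtain ⟨a, ha⟩ := exists_maxVal_succ_eq (c := -1) (k := k) (τ := τ) hg hb
  exact ⟨a, by simp only [minVal, mul_neg, Finset.sum_neg_distrib, ha]⟩

section Bounds

variable [Nonempty A] {x : S} {τ : List S → A → S → ℝ}

theorem maxVal_mem (hτ : M.IsPlan x τ) (k : ℕ) : maxVal 1 b g k x τ ∈ Set.Icc (0 : ℝ) 1 := by
  obtain ⟨σ, hσ, h⟩ := exists_untilProb_eq_maxVal b g k x τ
  exact h ▸ ⟨untilProb_nonneg k hσ hτ, untilProb_le_one k hσ hτ⟩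

theorem minVal_mem (hτ : M.IsPlan x τ) (k : ℕ) : minVal b g k x τ ∈ Set.Icc (0 : ℝ) 1 := by
  obtain ⟨σ, hσ, h⟩ := exists_untilProb_eq_minVal b g k x τ
  exact h ▸ ⟨untilProb_nonneg k hσ hτ, untilProb_le_one k hσ hτ⟩

theorem maxVal_mono (b g : S → Prop) (hτ : M.IsPlan x τ) :
    Monotone fun k => maxVal 1 b g k x τ := by
  refine monotone_nat_of_le_succ fun k => ?_
  obtain ⟨σ, hσ, h⟩ := exists_untilProb_eq_maxVal b g k x τ
  exact h ▸ (untilProb_le_succ k hσ hτ).trans (untilProb_le_maxVal _ hσ hτ)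

theorem minVal_mono (b g : S → Prop) (hτ : M.IsPlan x τ) :
    Monotone fun k => minVal b g k x τ := by
  refine monotone_nat_of_le_succ fun k => ?_
  obtain ⟨σ, hσ, h⟩ := exists_untilProb_eq_minVal b g (k + 1) x τ
  exact h ▸ (minVal_le_untilProb _ hσ hτ).trans (untilProb_le_succ k hσ hτ)

theorem bddAbove_maxVal (b g : S → Prop) (hτ : M.IsPlan x τ) :
    BddAbove (Set.range fun k => maxVal 1 b g k x τ) :=
  ⟨1, by rintro _ ⟨k, rfl⟩; exact (maxVal_mem hτ k).2⟩

theorem bddAbove_minVal (b g : S → Prop) (hτ : M.IsPlan x τ) :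
    BddAbove (Set.range fun k => minVal b g k x τ) :=
  ⟨1, by rintro _ ⟨k, rfl⟩; exact (minVal_mem hτ k).2⟩

end Bounds

/-- The supremum over all schedulers of the probability of reaching `g` while staying in `b`. -/
noncomputable def supVal (b g : S → Prop) (x : S) (τ : List S → A → S → ℝ) : ℝ :=
  ⨆ k, maxVal 1 b g k x τ

/-- The infimum over all schedulers of the probability of reaching `g` while staying in `b`. -/
noncomputable def infVal (b g : S → Prop) (x : S) (τ : List S → A → S → ℝ) : ℝ :=
  ⨆ k, minVal b g k x τ

section Limit

variable [Nonempty A] {x : S} {τ : List S → A → S → ℝ}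

theorem maxVal_le_supVal (hτ : M.IsPlan x τ) (k : ℕ) : maxVal 1 b g k x τ ≤ supVal b g x τ :=
  le_ciSup (bddAbove_maxVal b g hτ) k

theorem minVal_le_infVal (hτ : M.IsPlan x τ) (k : ℕ) : minVal b g k x τ ≤ infVal b g x τ :=
  le_ciSup (bddAbove_minVal b g hτ) k

theorem infVal_mem (hτ : M.IsPlan x τ) : infVal b g x τ ∈ Set.Icc (0 : ℝ) 1 :=
  ⟨(minVal_mem hτ 0).1.trans (minVal_le_infVal hτ 0), ciSup_le fun k => (minVal_mem hτ k).2⟩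

theorem tendsto_maxVal (b g : S → Prop) (hτ : M.IsPlan x τ) :
    Tendsto (fun k => maxVal 1 b g k x τ) atTop (𝓝 (supVal b g x τ)) :=
  tendsto_atTop_ciSup (maxVal_mono b g hτ) (bddAbove_maxVal b g hτ)

theorem tendsto_minVal (b g : S → Prop) (hτ : M.IsPlan x τ) :
    Tendsto (fun k => minVal b g k x τ) atTop (𝓝 (infVal b g x τ)) :=
  tendsto_atTop_ciSup (minVal_mono b g hτ) (bddAbove_minVal b g hτ)

theorem infVal_of_goal (hg : g x) : infVal b g x τ = 1 := by
  simp [infVal, minVal, maxVal_of_goal hg]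

theorem infVal_of_not (hg : ¬ g x) (hb : ¬ b x) : infVal b g x τ = 0 := by
  simp [infVal, minVal, maxVal_of_not hg hb]

theorem sum_supVal_le (hτ : M.IsPlan x τ) (hg : ¬ g x) (hb : b x) (a : A) :
    ∑ y, τ [] a y * supVal b g y (after τ y) ≤ supVal b g x τ := by
  have h : Tendsto (fun k => ∑ y, τ [] a y * maxVal 1 b g k y (after τ y)) atTop
      (𝓝 (∑ y, τ [] a y * supVal b g y (after τ y))) :=
    tendsto_finsetSum _ fun y _ => (tendsto_maxVal b g (hτ.after y)).const_mul _
  exact le_of_tendsto' h fun k => (sum_le_maxVal_succ hg hb a).trans (maxVal_le_supVal hτ _)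

theorem infVal_le_sum (hτ : M.IsPlan x τ) (hg : ¬ g x) (hb : b x) (a : A) :
    infVal b g x τ ≤ ∑ y, τ [] a y * infVal b g y (after τ y) := by
  refine ciSup_le fun k => ?_
  refine (minVal_mono b g hτ k.le_succ).trans ((minVal_succ_le hg hb a).trans ?_)
  exact sum_mul_mono (hτ.head a).1 fun y => minVal_le_infVal (hτ.after y) k

/-- A minimising action may depend on the horizon, but finiteness of `A` yields one good for all
horizons: if each action failed at some horizon, monotonicity would make all fail at a common one,
where a minimising action exists. -/
theorem exists_sum_infVal_le (hτ : M.IsPlan x τ) (hg : ¬ g x) (hb : b x) :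
    ∃ a, ∑ y, τ [] a y * infVal b g y (after τ y) ≤ infVal b g x τ := by
  have key : ∃ a, ∀ k, ∑ y, τ [] a y * minVal b g k y (after τ y) ≤ infVal b g x τ := by
    by_contra! hcon
    choose K hK using hcon
    obtain ⟨N, hN⟩ := (Set.finite_range K).bddAbove
    obtain ⟨a, ha⟩ := exists_minVal_succ_eq (k := N) (τ := τ) hg hb
    have h1 : ∑ y, τ [] a y * minVal b g (K a) y (after τ y) ≤
        ∑ y, τ [] a y * minVal b g N y (after τ y) :=
      sum_mul_mono (hτ.head a).1 fun y => minVal_mono b g (hτ.after y) (hN ⟨a, rfl⟩)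
    have h2 := minVal_le_infVal (b := b) (g := g) hτ (N + 1)
    linarith [hK a]
  obtain ⟨a, ha⟩ := key
  have h : Tendsto (fun k => ∑ y, τ [] a y * minVal b g k y (after τ y)) atTop
      (𝓝 (∑ y, τ [] a y * infVal b g y (after τ y))) :=
    tendsto_finsetSum _ fun y _ => (tendsto_minVal b g (hτ.after y)).const_mul _
  exact ⟨a, le_of_tendsto' h ha⟩

/-- The scheduler that follows the choice `α` along the residual strategies of nature. -/
def greedy (α : S → (List S → A → S → ℝ) → A → ℝ) :
    List S → S → (List S → A → S → ℝ) → A → ℝ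
  | [], x, τ => α x τ
  | y :: l, _, τ => greedy α l y (after τ y)

/-- The infimum over schedulers is attained: always playing an action that does not increase the
expected `infVal` keeps every finite-horizon probability below it. -/
theorem exists_untilProb_le_infVal (hτ : M.IsPlan x τ) :
    ∃ σ, IsSched σ ∧ ∀ k, untilProb b g k x σ τ ≤ infVal b g x τ := by
  classical
  have H : ∀ (x : S) (τ : List S → A → S → ℝ), ∃ a : A, M.IsPlan x τ → ¬ g x → b x →
      ∑ y, τ [] a y * infVal b g y (after τ y) ≤ infVal b g x τ := by
    intro x τ
    by_cases h : M.IsPlan x τ ∧ ¬ g x ∧ b x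
    · obtain ⟨a, ha⟩ := exists_sum_infVal_le h.1 h.2.1 h.2.2
      exact ⟨a, fun _ _ _ => ha⟩
    · exact ⟨Classical.arbitrary A, fun h1 h2 h3 => absurd ⟨h1, h2, h3⟩ h⟩
  choose a ha using H
  let σ : S → (List S → A → S → ℝ) → List S → A → ℝ :=
    fun x τ l => greedy (fun x τ => Pi.single (a x τ) 1) l x τ
  have hσ : ∀ x τ, IsSched (σ x τ) := by
    intro x τ l
    induction l generalizing x τ with
    | nil => exact single_mem_stdSimplex _ _
    | cons y l ih => exact ih y (after τ y)
  refine ⟨σ x τ, hσ x τ, fun k => ?_⟩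
  induction k generalizing x τ with
  | zero =>
    by_cases hg : g x
    · rw [untilProb_of_goal hg, infVal_of_goal hg]
    · rw [untilProb, if_neg hg]; exact (infVal_mem hτ).1
  | succ k ih =>
    by_cases hg : g x
    · rw [untilProb_of_goal hg, infVal_of_goal hg]
    by_cases hb : b x
    · rw [untilProb_succ hg hb, show σ x τ [] = Pi.single (a x τ) 1 from rfl, mix_single]
      exact (sum_mul_mono (hτ.head _).1 fun y => ih (hτ.after y)).trans (ha x τ hτ hg hb)
    · rw [untilProb_of_not hg hb, infVal_of_not hg hb]

end Limit

end Value

/-! ### Imitating a strategy of nature along a bisimulation -/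

section Bisimulation

variable {S A AP : Type*} [Fintype S] [Fintype A] {M : IMDP S A AP} {b g : S → Prop}
  {R : S → S → Prop}

theorem sum_mul_quot [Fintype (Quot R)] (μ : S → ℝ) (F : Quot R → ℝ) :
    ∑ y, μ y * F (Quot.mk R y) = ∑ C, classMass R μ C * F C := by
  classical
  simp only [classMass, Finset.sum_mul]
  rw [Finset.sum_comm]
  refine Finset.sum_congr rfl fun y _ => ?_
  simp [Set.indicator_apply]

/-- The family `ν` of distributions simulates the family `μ`: each mixture of `ν` agrees with some
mixture of `μ` on the classes of `R`. -/
def Simulates (R : S → S → Prop) (ν μ : A → S → ℝ) : Prop :=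
  ∀ ρ' ∈ stdSimplex ℝ A, ∃ ρ ∈ stdSimplex ℝ A, ∀ F : Quot R → ℝ,
    ∑ y, mix ρ' ν y * F (Quot.mk R y) = ∑ y, mix ρ μ y * F (Quot.mk R y)

theorem IMDP.IsBisimulation.exists_simulates (h : M.IsBisimulation R) {s t : S}
    (hst : Quot.mk R s = Quot.mk R t) {μ : A → S → ℝ} (hμ : ∀ a, μ a ∈ M.feasible s a) :
    ∃ ν : A → S → ℝ, (∀ a, ν a ∈ M.feasible t a) ∧ Simulates R ν μ := by
  classical
  have key : ∀ s t, R s t → ∀ μ : A → S → ℝ, (∀ a, μ a ∈ M.feasible s a) →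
      ∃ ν : A → S → ℝ, (∀ a, ν a ∈ M.feasible t a) ∧ Simulates R ν μ := by
    intro s t hst μ hμ
    obtain ⟨ν, hν, H⟩ := h.step s t hst μ hμ
    refine ⟨ν, hν, fun ρ' hρ' => ?_⟩
    obtain ⟨_, ⟨ρ, hρ, rfl⟩, hC⟩ := H _ ⟨ρ', hρ', rfl⟩
    have : Fintype (Quot R) := Fintype.ofFinite _
    exact ⟨ρ, hρ, fun F => by simp only [sum_mul_quot, hC]⟩
  -- Both directions are carried together so that the symmetric case of the generated equivalence is
  -- immediate.
  have main : ∀ s t, Relation.EqvGen R s t →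
      (∀ μ : A → S → ℝ, (∀ a, μ a ∈ M.feasible s a) →
        ∃ ν : A → S → ℝ, (∀ a, ν a ∈ M.feasible t a) ∧ Simulates R ν μ) ∧
      (∀ μ : A → S → ℝ, (∀ a, μ a ∈ M.feasible t a) →
        ∃ ν : A → S → ℝ, (∀ a, ν a ∈ M.feasible s a) ∧ Simulates R ν μ) := by
    intro s t hst
    induction hst with
    | rel s t hr => exact ⟨key s t hr, key t s (h.symm _ _ hr)⟩
    | refl s => exact ⟨fun μ hμ => ⟨μ, hμ, fun ρ hρ => ⟨ρ, hρ, fun _ => rfl⟩⟩,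
        fun μ hμ => ⟨μ, hμ, fun ρ hρ => ⟨ρ, hρ, fun _ => rfl⟩⟩⟩
    | symm s t _ ih => exact ih.symm
    | trans s t u _ _ ih1 ih2 =>
      have comp : ∀ {ν₁ ν₂ ν₃ : A → S → ℝ}, Simulates R ν₁ ν₂ → Simulates R ν₂ ν₃ →
          Simulates R ν₁ ν₃ := by
        intro ν₁ ν₂ ν₃ h1 h2 ρ hρ
        obtain ⟨ρ₂, hρ₂, e1⟩ := h1 ρ hρ
        obtain ⟨ρ₃, hρ₃, e2⟩ := h2 ρ₂ hρ₂
        exact ⟨ρ₃, hρ₃, fun F => (e1 F).trans (e2 F)⟩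
      constructor
      · intro μ hμ
        obtain ⟨ν, hν, h1⟩ := ih1.1 μ hμ
        obtain ⟨ν', hν', h2⟩ := ih2.1 ν hν
        exact ⟨ν', hν', comp h2 h1⟩
      · intro μ hμ
        obtain ⟨ν, hν, h1⟩ := ih2.2 μ hμ
        obtain ⟨ν', hν', h2⟩ := ih1.2 ν hν
        exact ⟨ν', hν', comp h2 h1⟩
  exact (main s t (Quot.eqvGen_exact hst)).1 μ hμ

/-- Replacing `f` by its minimum on each class gives a class function below `f`, to which the
matching of class masses applies. -/
theorem exists_argmin (R : S → S → Prop) (f : S → ℝ) :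
    ∃ m : Quot R → S, (∀ C, Quot.mk R (m C) = C) ∧ ∀ x, f (m (Quot.mk R x)) ≤ f x := by
  classical
  have H : ∀ C : Quot R, ∃ x, Quot.mk R x = C ∧ ∀ y, Quot.mk R y = C → f x ≤ f y := by
    intro C
    obtain ⟨x₀, hx₀⟩ := Quot.exists_rep C
    obtain ⟨x, hx, h⟩ := (Finset.univ.filter fun x => Quot.mk R x = C).exists_min_image f
      ⟨x₀, by simpa using hx₀⟩
    exact ⟨x, by simpa using hx, fun y hy => h y (by simpa using hy)⟩
  choose m h1 h2 using H
  exact ⟨m, h1, fun x => h2 _ x rfl⟩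

/-- A set of states is a union of classes. -/
def Saturated (R : S → S → Prop) (b : S → Prop) : Prop :=
  ∀ x y, Quot.mk R x = Quot.mk R y → (b x ↔ b y)

theorem IMDP.IsBisimulation.exists_maxVal_le [Nonempty A] (h : M.IsBisimulation R)
    (hb : Saturated R b) (hg : Saturated R g) (c : ℝ) (k : ℕ) {s t : S}
    (hst : Quot.mk R s = Quot.mk R t) {τ : List S → A → S → ℝ} (hτ : M.IsPlan s τ) :
    ∃ τ', M.IsPlan t τ' ∧ maxVal c b g k t τ' ≤ maxVal c b g k s τ := by
  induction k generalizing s t τ with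
  | zero =>
    obtain ⟨τ', hτ'⟩ := M.exists_isPlan t
    exact ⟨τ', hτ', (maxVal_zero_congr (hg s t hst)).le⟩
  | succ k ih =>
    by_cases hgs : g s
    · obtain ⟨τ', hτ'⟩ := M.exists_isPlan t
      exact ⟨τ', hτ', by rw [maxVal_of_goal hgs, maxVal_of_goal ((hg s t hst).1 hgs)]⟩
    by_cases hbs : b s
    · obtain ⟨m, hm, hmin⟩ := exists_argmin R fun y => maxVal c b g k y (after τ y)
      -- After moving to `y`, nature imitates the residual strategy of the representative of the
      -- class of `y` where the scheduler's value is least.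
      choose τ' hτ' hle using fun y : S => ih (hm (Quot.mk R y)) (hτ.after (m (Quot.mk R y)))
      obtain ⟨ν, hν, hsim⟩ := h.exists_simulates hst hτ.head
      refine ⟨consPlan ν τ', M.isPlan_consPlan hν hτ', ?_⟩
      rw [maxVal_succ (mt (hg s t hst).2 hgs) ((hb s t hst).1 hbs)]
      refine ciSup_le fun a => ?_
      classical
      -- The single action `a` against `ν` corresponds to a mixture `ρ` against the original first
      -- move, which is no better than its best action.
      obtain ⟨ρ, hρ, e⟩ := hsim _ (single_mem_stdSimplex ℝ a)
      rw [mix_single] at e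
      calc _ ≤ ∑ y, ν a y * maxVal c b g k (m (Quot.mk R y)) (after τ (m (Quot.mk R y))) :=
            sum_mul_mono (hν a).1 hle
        _ = ∑ y, mix ρ (τ []) y * maxVal c b g k (m (Quot.mk R y)) (after τ (m (Quot.mk R y))) :=
            e fun C => maxVal c b g k (m C) (after τ (m C))
        _ ≤ ∑ y, mix ρ (τ []) y * maxVal c b g k y (after τ y) :=
            sum_mul_mono (mix_mem hρ fun a => (hτ.head a).1) hmin
        _ ≤ _ := by
            rw [sum_mix_mul]
            exact sum_mul_le_of_le hρ fun a => sum_le_maxVal_succ hgs hbs a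
    · obtain ⟨τ', hτ'⟩ := M.exists_isPlan t
      exact ⟨τ', hτ', by rw [maxVal_of_not hgs hbs,
        maxVal_of_not (mt (hg s t hst).2 hgs) (mt (hb s t hst).2 hbs)]⟩

theorem IMDP.IsBisimulation.exists_minVal_ge [Nonempty A] (h : M.IsBisimulation R)
    (hb : Saturated R b) (hg : Saturated R g) (k : ℕ) {s t : S}
    (hst : Quot.mk R s = Quot.mk R t) {τ : List S → A → S → ℝ} (hτ : M.IsPlan s τ) :
    ∃ τ', M.IsPlan t τ' ∧ minVal b g k s τ ≤ minVal b g k t τ' := by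
  obtain ⟨τ', hτ', hle⟩ := h.exists_maxVal_le hb hg (-1) k hst hτ
  exact ⟨τ', hτ', neg_le_neg hle⟩

/-- The move and the residual strategy of nature against which it is evaluated, when a history of
the simulating process is matched with a history of the simulated one. -/
def simPlan (respond : S → S → (List S → A → S → ℝ) → A → S → ℝ)
    (pick : (List S → A → S → ℝ) → S → S) :
    List S → S → S → (List S → A → S → ℝ) → A → S → ℝ
  | [], t, s, τ => respond t s τ
  | y :: l, _, _, τ => simPlan respond pick l y (pick τ y) (after τ (pick τ y))

/-- Representatives are selected by `supVal` instead of a finite-horizon value, so a single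
imitating strategy serves all horizons. The induction bounds its `k`-step value by the unbounded
value of the imitated strategy. -/
theorem IMDP.IsBisimulation.exists_supVal_le [Nonempty A] (h : M.IsBisimulation R)
    (hb : Saturated R b) (hg : Saturated R g) {s t : S}
    (hst : Quot.mk R s = Quot.mk R t) {τ : List S → A → S → ℝ} (hτ : M.IsPlan s τ) :
    ∃ τ', M.IsPlan t τ' ∧ supVal b g t τ' ≤ supVal b g s τ := by
  -- Feasibility is unconditional, so the recursively defined strategy is a plan on every history;
  -- simulation is claimed only for matched arguments.
  have H1 : ∀ (t s : S) (τ : List S → A → S → ℝ), ∃ ν : A → S → ℝ, (∀ a, ν a ∈ M.feasible t a) ∧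
      (Quot.mk R s = Quot.mk R t → M.IsPlan s τ → Simulates R ν (τ [])) := by
    intro t s τ
    by_cases hc : Quot.mk R s = Quot.mk R t ∧ M.IsPlan s τ
    · obtain ⟨ν, hν, hsim⟩ := h.exists_simulates hc.1 hc.2.head
      exact ⟨ν, hν, fun _ _ => hsim⟩
    · obtain ⟨τ', hτ'⟩ := M.exists_isPlan (A := A) t
      exact ⟨τ' [], hτ'.head, fun h1 h2 => absurd ⟨h1, h2⟩ hc⟩
  choose respond hfeas hsim using H1
  choose m hm hmin using
    fun τ : List S → A → S → ℝ => exists_argmin R fun y => supVal b g y (after τ y)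
  let pick : (List S → A → S → ℝ) → S → S := fun τ y => m τ (Quot.mk R y)
  let π : S → S → (List S → A → S → ℝ) → List S → A → S → ℝ :=
    fun t s τ l => simPlan respond pick l t s τ
  have hπ : ∀ t s τ, M.IsPlan t (π t s τ) := by
    intro t s τ l a
    induction l generalizing t s τ with
    | nil => exact hfeas t s τ a
    | cons y l ih => rw [List.getLastD_cons]; exact ih y _ _
  refine ⟨π t s τ, hπ t s τ, ciSup_le fun k => ?_⟩
  induction k generalizing t s τ with
  | zero =>
    refine le_trans ?_ (maxVal_le_supVal hτ 0)
    exact (maxVal_zero_congr (hg s t hst)).le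
  | succ k ih =>
    by_cases hgs : g s
    · refine le_trans ?_ (maxVal_le_supVal hτ 0)
      rw [maxVal_of_goal hgs, maxVal_of_goal ((hg s t hst).1 hgs)]
    by_cases hbs : b s
    · rw [maxVal_succ (mt (hg s t hst).2 hgs) ((hb s t hst).1 hbs)]
      refine ciSup_le fun a => ?_
      classical
      obtain ⟨ρ, hρ, e⟩ := hsim t s τ hst hτ _ (single_mem_stdSimplex ℝ a)
      rw [mix_single] at e
      calc _ ≤ ∑ y, respond t s τ a y * supVal b g (m τ (Quot.mk R y))
              (after τ (m τ (Quot.mk R y))) :=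
            sum_mul_mono (hfeas t s τ a).1 fun y => ih (hm τ _) (hτ.after _)
        _ = ∑ y, mix ρ (τ []) y * supVal b g (m τ (Quot.mk R y))
              (after τ (m τ (Quot.mk R y))) :=
            e fun C => supVal b g (m τ C) (after τ (m τ C))
        _ ≤ ∑ y, mix ρ (τ []) y * supVal b g y (after τ y) :=
            sum_mul_mono (mix_mem hρ fun a => (hτ.head a).1) (hmin τ)
        _ ≤ _ := by
            rw [sum_mix_mul]
            exact sum_mul_le_of_le hρ fun a => sum_supVal_le hτ hgs hbs a
    · refine le_trans ?_ (maxVal_le_supVal hτ 0)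
      rw [maxVal_of_not hgs hbs,
        maxVal_of_not (mt (hg s t hst).2 hgs) (mt (hb s t hst).2 hbs)]

end Bisimulation

/-! ### The reachability game and uniformly good schedulers -/

section Game

open Filter Topology

variable {S A AP : Type*} [Fintype S] [Fintype A] (M : IMDP S A AP) (b g : S → Prop)

/-- The least expected value of `f` after one step from `x` under the action `a`. -/
noncomputable def IMDP.stepInf (x : S) (a : A) (f : S → ℝ) : ℝ :=
  ⨅ μ : M.feasible x a, ∑ y, μ.1 y * f y

open scoped Classical in
/-- The value of the game in which the scheduler tries to reach `g` within fewer than `k` steps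
while staying in `b`, and nature tries to prevent it. -/
noncomputable def IMDP.gameVal : ℕ → S → ℝ
  | 0, _ => 0
  | k + 1, x => if g x then 1 else if b x then ⨆ a, M.stepInf x a (IMDP.gameVal k) else 0

variable {M b g}

instance (x : S) (a : A) : Nonempty (M.feasible x a) := by
  obtain ⟨μ, h1, h2⟩ := M.feasible_nonempty x a
  exact ⟨⟨μ, h1, h2⟩⟩

theorem stepInf_le {x : S} {a : A} {f : S → ℝ} (hf : ∀ y, 0 ≤ f y) {μ : S → ℝ}
    (hμ : μ ∈ M.feasible x a) : M.stepInf x a f ≤ ∑ y, μ y * f y :=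
  ciInf_le (f := fun μ : M.feasible x a => ∑ y, μ.1 y * f y)
    ⟨0, by rintro _ ⟨μ, rfl⟩; exact Finset.sum_nonneg fun y _ => mul_nonneg (μ.2.1.1 y) (hf y)⟩
    ⟨μ, hμ⟩

theorem le_stepInf {x : S} {a : A} {f : S → ℝ} {r : ℝ}
    (h : ∀ μ ∈ M.feasible x a, r ≤ ∑ y, μ y * f y) : r ≤ M.stepInf x a f :=
  le_ciInf fun μ => h μ.1 μ.2

variable [Nonempty A]

theorem gameVal_of_goal {k : ℕ} {x : S} (hg : g x) : M.gameVal b g (k + 1) x = 1 := by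
  simp [IMDP.gameVal, hg]

theorem gameVal_of_not {k : ℕ} {x : S} (hg : ¬ g x) (hb : ¬ b x) : M.gameVal b g k x = 0 := by
  cases k <;> simp [IMDP.gameVal, hg, hb]

theorem gameVal_succ {k : ℕ} {x : S} (hg : ¬ g x) (hb : b x) :
    M.gameVal b g (k + 1) x = ⨆ a, M.stepInf x a (M.gameVal b g k) := by
  simp [IMDP.gameVal, hg, hb]

theorem stepInf_le_gameVal {k : ℕ} {x : S} (hg : ¬ g x) (hb : b x) (a : A) :
    M.stepInf x a (M.gameVal b g k) ≤ M.gameVal b g (k + 1) x := by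
  rw [gameVal_succ hg hb]
  exact le_ciSup (f := fun a => M.stepInf x a (M.gameVal b g k)) (Set.finite_range _).bddAbove a

theorem gameVal_mem (k : ℕ) (x : S) : M.gameVal b g k x ∈ Set.Icc (0 : ℝ) 1 := by
  induction k generalizing x with
  | zero => simp [IMDP.gameVal]
  | succ k ih =>
    by_cases hg : g x
    · rw [gameVal_of_goal hg]; simp
    by_cases hb : b x
    · constructor
      · refine le_trans (le_stepInf fun μ hμ => ?_)
          (stepInf_le_gameVal hg hb (Classical.arbitrary A))
        exact Finset.sum_nonneg fun y _ => mul_nonneg (hμ.1.1 y) (ih y).1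
      · rw [gameVal_succ hg hb]
        refine ciSup_le fun a => ?_
        obtain ⟨μ, hμ⟩ := (inferInstance : Nonempty (M.feasible x a))
        exact (stepInf_le (fun y => (ih y).1) hμ).trans (sum_mul_le_of_le hμ.1 fun y => (ih y).2)
    · rw [gameVal_of_not hg hb]; simp

theorem gameVal_le_succ (k : ℕ) (x : S) : M.gameVal b g k x ≤ M.gameVal b g (k + 1) x := by
  induction k generalizing x with
  | zero => exact (gameVal_mem 1 x).1
  | succ k ih =>
    by_cases hg : g x
    · rw [gameVal_of_goal hg, gameVal_of_goal hg]
    by_cases hb : b x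
    · rw [gameVal_succ hg hb]
      refine ciSup_le fun a => le_trans (le_stepInf fun μ hμ => ?_) (stepInf_le_gameVal hg hb a)
      exact (stepInf_le (fun y => (gameVal_mem k y).1) hμ).trans (sum_mul_mono hμ.1 ih)
    · rw [gameVal_of_not hg hb, gameVal_of_not hg hb]

theorem tendsto_gameVal (x : S) :
    Tendsto (fun k => M.gameVal b g k x) atTop (𝓝 (⨆ k, M.gameVal b g k x)) :=
  tendsto_atTop_ciSup (monotone_nat_of_le_succ fun k => gameVal_le_succ k x)
    ⟨1, by rintro _ ⟨k, rfl⟩; exact (gameVal_mem k x).2⟩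

theorem gameVal_le_iSup (k : ℕ) (x : S) : M.gameVal b g k x ≤ ⨆ k, M.gameVal b g k x :=
  le_ciSup (f := fun k => M.gameVal b g k x)
    ⟨1, by rintro _ ⟨k, rfl⟩; exact (gameVal_mem k x).2⟩ k

/-- Feasible sets need not be closed, so nature's infimum is only approached. Half of `ε` pays for a
horizon whose game values are near their limits in all states, half for a near-optimal `μ` at that
horizon. -/
theorem exists_feasible_sum_le {x : S} (hg : ¬ g x) (hb : b x) (a : A) {ε : ℝ} (hε : 0 < ε) :
    ∃ μ ∈ M.feasible x a,
      ∑ y, μ y * ⨆ k, M.gameVal b g k y ≤ (⨆ k, M.gameVal b g k x) + ε := by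
  have h : ∀ᶠ k in atTop, ∀ y, (⨆ k, M.gameVal b g k y) - ε / 2 < M.gameVal b g k y :=
    eventually_all.2 fun y => (tendsto_gameVal y).eventually_const_lt (by linarith)
  obtain ⟨k, hk⟩ := h.exists
  obtain ⟨⟨μ, hμ⟩, hlt⟩ := exists_lt_of_ciInf_lt
    (show M.stepInf x a (M.gameVal b g k) < M.stepInf x a (M.gameVal b g k) + ε / 2 by linarith)
  refine ⟨μ, hμ, ?_⟩
  have h1 : ∑ y, μ y * (⨆ k, M.gameVal b g k y) ≤ ∑ y, μ y * (M.gameVal b g k y + ε / 2) :=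
    sum_mul_mono hμ.1 fun y => by linarith [hk y]
  simp only [mul_add, Finset.sum_add_distrib, ← Finset.sum_mul, hμ.1.2, one_mul] at h1
  have h2 := stepInf_le_gameVal (M := M) (k := k) hg hb a
  have h3 := gameVal_le_iSup (M := M) (b := b) (g := g) (k + 1) x
  simp only at hlt
  linarith

/-- Play `μ y ε` in the state `y` reached, where the tolerance `ε` is halved in each step. -/
noncomputable def halvingPlan (μ : S → ℝ → A → S → ℝ) : List S → S → ℝ → A → S → ℝ
  | [], x, ε => μ x (ε / 2)
  | y :: l, _, ε => halvingPlan μ l y (ε / 2)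

theorem exists_supVal_le_gameVal (M : IMDP S A AP) (b g : S → Prop) (x : S) {ε : ℝ}
    (hε : 0 < ε) :
    ∃ τ, M.IsPlan x τ ∧ supVal b g x τ ≤ (⨆ k, M.gameVal b g k x) + ε := by
  have H : ∀ (x : S) (ε : ℝ) (a : A), ∃ μ ∈ M.feasible x a, ¬ g x → b x → 0 < ε →
      ∑ y, μ y * ⨆ k, M.gameVal b g k y ≤ (⨆ k, M.gameVal b g k x) + ε := by
    intro x ε a
    by_cases hc : ¬ g x ∧ b x ∧ 0 < ε
    · obtain ⟨μ, hμ, h⟩ := exists_feasible_sum_le (M := M) hc.1 hc.2.1 a hc.2.2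
      exact ⟨μ, hμ, fun _ _ _ => h⟩
    · obtain ⟨μ, hμ⟩ := (inferInstance : Nonempty (M.feasible x a))
      exact ⟨μ, hμ, fun h1 h2 h3 => absurd ⟨h1, h2, h3⟩ hc⟩
  choose μ hμ hle using H
  let π : S → ℝ → List S → A → S → ℝ := fun x ε l => halvingPlan μ l x ε
  have hπ : ∀ x ε, M.IsPlan x (π x ε) := by
    intro x ε l a
    induction l generalizing x ε with
    | nil => exact hμ x _ a
    | cons y l ih => rw [List.getLastD_cons]; exact ih y _
  have hW : ∀ x, 0 ≤ ⨆ k, M.gameVal b g k x := fun x =>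
    (gameVal_mem 0 x).1.trans (gameVal_le_iSup 0 x)
  refine ⟨π x ε, hπ x ε, ciSup_le fun k => ?_⟩
  induction k generalizing x ε with
  | zero =>
    by_cases hg : g x
    · rw [maxVal_of_goal hg]
      have := gameVal_le_iSup (M := M) (b := b) (g := g) 1 x
      rw [gameVal_of_goal hg] at this
      linarith
    · rw [maxVal_zero_of_not hg]
      linarith [hW x]
  | succ k ih =>
    by_cases hg : g x
    · rw [maxVal_of_goal hg]
      have := gameVal_le_iSup (M := M) (b := b) (g := g) 1 x
      rw [gameVal_of_goal hg] at this
      linarith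
    by_cases hb : b x
    · rw [maxVal_succ hg hb]
      refine ciSup_le fun a => ?_
      -- The present move loses at most `ε / 2`, and the residual strategies, started with tolerance
      -- `ε / 2`, lose at most that much in total.
      have h1 : ∑ y, μ x (ε / 2) a y * maxVal 1 b g k y (after (π x ε) y) ≤
          ∑ y, μ x (ε / 2) a y * ((⨆ k, M.gameVal b g k y) + ε / 2) :=
        sum_mul_mono (hμ x _ a).1 fun y => ih y (half_pos hε)
      simp only [mul_add, Finset.sum_add_distrib, ← Finset.sum_mul, (hμ x _ a).1.2, one_mul] at h1
      have h2 := hle x (ε / 2) a hg hb (half_pos hε)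
      refine h1.trans ?_
      linarith
    · rw [maxVal_of_not hg hb]
      linarith [hW x]

/-- The scheduler that always plays the action `α y` in the state `y`. -/
noncomputable def statSched [DecidableEq A] (α : S → A) (x : S) : List S → A → ℝ :=
  fun l => Pi.single (α (l.getLastD x)) 1

theorem isSched_statSched [DecidableEq A] (α : S → A) (x : S) : IsSched (statSched α x) :=
  fun _ => single_mem_stdSimplex _ _

theorem after_statSched [DecidableEq A] (α : S → A) (x y : S) :
    after (statSched α x) y = statSched α y := by
  funext l
  simp only [after, statSched, List.getLastD_cons]

/-- The factor `β` forces progress: whatever part of `f` has not been turned into reaching `g` after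
`k` steps is at most `β ^ k`. With `β = 1` the scheduler could preserve `f` forever without reaching
`g`. -/
theorem le_iSup_untilProb_statSched [DecidableEq A] {β : ℝ} (hβ0 : 0 ≤ β) (hβ1 : β < 1)
    {f : S → ℝ} (hf : ∀ x, f x ≤ 1) (hbad : ∀ x, ¬ g x → ¬ b x → f x ≤ 0) {α : S → A}
    (hα : ∀ x, ¬ g x → b x → ∀ μ ∈ M.feasible x (α x), f x ≤ β * ∑ y, μ y * f y)
    {x : S} {τ : List S → A → S → ℝ} (hτ : M.IsPlan x τ) :
    f x ≤ ⨆ k, untilProb b g k x (statSched α x) τ := by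
  have key : ∀ k (x : S) (τ : List S → A → S → ℝ), M.IsPlan x τ →
      f x ≤ untilProb b g k x (statSched α x) τ + β ^ k := by
    intro k
    induction k with
    | zero =>
      intro x τ hτ
      rw [pow_zero]
      linarith [hf x, untilProb_nonneg (b := b) (g := g) 0 (isSched_statSched α x) hτ]
    | succ k ih =>
      intro x τ hτ
      have hpow := pow_nonneg hβ0 (k + 1)
      by_cases hg : g x
      · rw [untilProb_of_goal hg]; linarith [hf x]
      by_cases hb : b x
      · rw [untilProb_succ hg hb]
        simp only [after_statSched]
        rw [show statSched α x [] = Pi.single (α x) 1 from rfl, mix_single]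
        have h1 := hα x hg hb _ (hτ.head (α x))
        have h2 := sum_mul_mono (hτ.head (α x)).1 fun y => ih y _ (hτ.after y)
        simp only [mul_add, Finset.sum_add_distrib, ← Finset.sum_mul, (hτ.head (α x)).1.2,
          one_mul] at h2
        have h3 : 0 ≤ ∑ y, τ [] (α x) y * untilProb b g k y (statSched α y) (after τ y) :=
          Finset.sum_nonneg fun y _ => mul_nonneg ((hτ.head (α x)).1.1 y)
            (untilProb_nonneg k (isSched_statSched α y) (hτ.after y))
        have h4 := mul_le_mul_of_nonneg_left h2 hβ0
        have h5 := mul_le_mul_of_nonneg_right hβ1.le h3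
        rw [pow_succ']
        linarith
      · rw [untilProb_of_not hg hb]; linarith [hbad x hg hb]
  have hlim : Tendsto (fun k : ℕ => (⨆ k, untilProb b g k x (statSched α x) τ) + β ^ k) atTop
      (𝓝 ((⨆ k, untilProb b g k x (statSched α x) τ) + 0)) :=
    (tendsto_pow_atTop_nhds_zero_of_lt_one hβ0 hβ1).const_add _
  rw [add_zero] at hlim
  refine ge_of_tendsto' hlim fun k => (key k x τ hτ).trans ?_
  have := le_ciSup (bddAbove_untilProb (b := b) (g := g) (isSched_statSched α x) hτ) k
  linarith

theorem exists_statSched_ge [DecidableEq A] (M : IMDP S A AP) (b g : S → Prop) (k : ℕ) (x : S)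
    {β : ℝ} (hβ0 : 0 ≤ β) (hβ1 : β < 1) :
    ∃ α : S → A, ∀ τ, M.IsPlan x τ →
      β ^ k * M.gameVal b g k x ≤ ⨆ n, untilProb b g n x (statSched α x) τ := by
  have hne : (Finset.range (k + 1)).Nonempty := ⟨0, by simp⟩
  -- At a horizon `j` attaining the maximum, an optimal first action leads to values at horizon `j -
  -- 1`, which are again below `f` after one factor `β` is split off. Hence one action per state
  -- suffices. The term `j = 0` makes `f` nonnegative.
  let f : S → ℝ := fun x => (Finset.range (k + 1)).sup' hne fun j => β ^ j * M.gameVal b g j x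
  have hfle : ∀ j ≤ k, ∀ x, β ^ j * M.gameVal b g j x ≤ f x := fun j hj x =>
    Finset.le_sup' (fun j => β ^ j * M.gameVal b g j x) (Finset.mem_range.2 (by omega))
  have hf0 : ∀ x, 0 ≤ f x := fun x => by simpa [IMDP.gameVal] using hfle 0 k.zero_le x
  have hα : ∀ x, ∃ a, ¬ g x → b x → ∀ μ ∈ M.feasible x a, f x ≤ β * ∑ y, μ y * f y := by
    intro x
    by_cases hc : ¬ g x ∧ b x
    swap
    · exact ⟨Classical.arbitrary A, fun h1 h2 => absurd ⟨h1, h2⟩ hc⟩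
    obtain ⟨j, hj, hjeq⟩ := Finset.exists_mem_eq_sup' hne fun j => β ^ j * M.gameVal b g j x
    change f x = β ^ j * M.gameVal b g j x at hjeq
    cases j with
    | zero =>
      refine ⟨Classical.arbitrary A, fun _ _ μ hμ => ?_⟩
      rw [hjeq]
      simp only [IMDP.gameVal, mul_zero]
      exact mul_nonneg hβ0 (Finset.sum_nonneg fun y _ => mul_nonneg (hμ.1.1 y) (hf0 y))
    | succ i =>
      obtain ⟨a, ha⟩ := exists_eq_ciSup_of_finite (f := fun a => M.stepInf x a (M.gameVal b g i))
      refine ⟨a, fun _ _ μ hμ => ?_⟩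
      rw [hjeq, gameVal_succ hc.1 hc.2, ← ha, pow_succ', mul_assoc]
      refine mul_le_mul_of_nonneg_left ?_ hβ0
      calc β ^ i * M.stepInf x a (M.gameVal b g i)
          ≤ β ^ i * ∑ y, μ y * M.gameVal b g i y :=
            mul_le_mul_of_nonneg_left (stepInf_le (fun y => (gameVal_mem i y).1) hμ)
              (pow_nonneg hβ0 i)
        _ = ∑ y, μ y * (β ^ i * M.gameVal b g i y) := by
            rw [Finset.mul_sum]
            exact Finset.sum_congr rfl fun y _ => by ring
        _ ≤ _ := sum_mul_mono hμ.1 fun y =>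
            hfle i (by have := Finset.mem_range.1 hj; omega) y
  choose α hα using hα
  refine ⟨α, fun τ hτ => (hfle k le_rfl x).trans
    (le_iSup_untilProb_statSched hβ0 hβ1 (fun x => ?_) (fun x hg hb => ?_) hα hτ)⟩
  · exact Finset.sup'_le _ _ fun j _ =>
      mul_le_one₀ (pow_le_one₀ hβ0 hβ1.le) (gameVal_mem j x).1 (gameVal_mem j x).2
  · exact Finset.sup'_le _ _ fun j _ => by rw [gameVal_of_not hg hb, mul_zero]

/-- If the scheduler can force probabilities arbitrarily close to `p`, it can force `p`. -/
theorem exists_sched_forall_ge (M : IMDP S A AP) (b g : S → Prop) (x : S) {p : ℝ}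
    (h : ∀ τ, M.IsPlan x τ → p ≤ supVal b g x τ) :
    ∃ σ, IsSched σ ∧ ∀ τ, M.IsPlan x τ → p ≤ ⨆ k, untilProb b g k x σ τ := by
  classical
  have hp : p ≤ ⨆ k, M.gameVal b g k x := by
    refine le_of_forall_pos_le_add fun ε hε => ?_
    obtain ⟨τ, hτ, hle⟩ := exists_supVal_le_gameVal M b g x hε
    exact (h τ hτ).trans hle
  by_contra! hcon
  choose τ hτ hlt using fun α : S → A => hcon (statSched α x) (isSched_statSched α x)
  -- There are finitely many stationary schedulers, so the largest of their spoiled values is still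
  -- below `p`; a discounted finite-horizon game value then exceeds it.
  obtain ⟨α₀, hα₀⟩ := Finite.exists_max fun α : S → A =>
    ⨆ k, untilProb b g k x (statSched α x) (τ α)
  obtain ⟨k, hk⟩ := exists_lt_of_lt_ciSup ((hlt α₀).trans_le hp)
  have hcont : Tendsto (fun β : ℝ => β ^ k * M.gameVal b g k x) (𝓝[<] 1)
      (𝓝 (M.gameVal b g k x)) := by
    have : Continuous fun β : ℝ => β ^ k * M.gameVal b g k x := by fun_prop
    simpa using (this.tendsto 1).mono_left nhdsWithin_le_nhds
  obtain ⟨β, h1, h2, h3⟩ := ((hcont.eventually_const_lt hk).and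
    (Ioo_mem_nhdsLT (zero_lt_one (α := ℝ)))).exists
  obtain ⟨α, hα⟩ := exists_statSched_ge M b g k x h2.le h3
  exact absurd (h1.trans_le ((hα _ (hτ α)).trans (hα₀ α))) (lt_irrefl _)

end Game

/-! ### Attaining nature's best guarantee throughout a bisimulation class -/

section Attainment

open Filter Topology

variable {S A AP : Type*} [Fintype S] [Fintype A] [Nonempty A] {M : IMDP S A AP}
  {b g : S → Prop}

/-- The supremum over all strategies of nature of the least probability of reaching `g` while
staying in `b`. -/
noncomputable def IMDP.bestVal (M : IMDP S A AP) (b g : S → Prop) (x : S) : ℝ :=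
  ⨆ τ : {τ // M.IsPlan x τ}, infVal b g x τ.1

instance (x : S) : Nonempty {τ // M.IsPlan x τ} :=
  let ⟨τ, hτ⟩ := M.exists_isPlan x
  ⟨⟨τ, hτ⟩⟩

theorem infVal_le_bestVal {x : S} {τ : List S → A → S → ℝ} (hτ : M.IsPlan x τ) :
    infVal b g x τ ≤ M.bestVal b g x :=
  le_ciSup (f := fun τ : {τ // M.IsPlan x τ} => infVal b g x τ.1)
    ⟨1, by rintro _ ⟨τ, rfl⟩; exact (infVal_mem τ.2).2⟩ ⟨τ, hτ⟩

theorem bestVal_le_one (x : S) : M.bestVal b g x ≤ 1 := ciSup_le fun τ => (infVal_mem τ.2).2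

theorem exists_lt_infVal {x : S} {r : ℝ} (h : r < M.bestVal b g x) :
    ∃ τ, M.IsPlan x τ ∧ r < infVal b g x τ := by
  obtain ⟨⟨τ, hτ⟩, h⟩ := exists_lt_of_lt_ciSup h
  exact ⟨τ, hτ, h⟩

theorem eq_of_sum_mul_le {μ f f' : S → ℝ} (hμ : μ ∈ stdSimplex ℝ S) (hf : ∀ y, f y ≤ f' y)
    (h : ∑ y, μ y * f' y ≤ ∑ y, μ y * f y) {z : S} (hz : μ z ≠ 0) : f z = f' z := by
  have h1 := (Finset.sum_eq_sum_iff_of_le fun y _ =>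
    mul_le_mul_of_nonneg_left (hf y) (hμ.1 y)).1 (le_antisymm (sum_mul_mono hμ hf) h) z
    (Finset.mem_univ z)
  exact mul_left_cancel₀ hz h1

/-- The strategy `τ` attains the best value of nature in the state `x`. -/
def IMDP.Attains (M : IMDP S A AP) (b g : S → Prop) (x : S) (τ : List S → A → S → ℝ) : Prop :=
  M.IsPlan x τ ∧ infVal b g x τ = M.bestVal b g x

theorem IMDP.Attains.bestVal_le_sum {x : S} {τ : List S → A → S → ℝ} (h : M.Attains b g x τ)
    (hg : ¬ g x) (hb : b x) (a : A) : M.bestVal b g x ≤ ∑ y, τ [] a y * M.bestVal b g y := by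
  rw [← h.2]
  exact (infVal_le_sum h.1 hg hb a).trans
    (sum_mul_mono (h.1.head a).1 fun y => infVal_le_bestVal (h.1.after y))

/-- If the expected best value after `a` does not exceed the present one, there is no slack, so the
residual strategy must be optimal at every successor of positive probability. -/
theorem IMDP.Attains.after {x : S} {τ : List S → A → S → ℝ} (h : M.Attains b g x τ)
    (hg : ¬ g x) (hb : b x) {a : A}
    (ha : ∑ y, τ [] a y * M.bestVal b g y ≤ M.bestVal b g x) {z : S} (hz : τ [] a z ≠ 0) :
    M.Attains b g z (after τ z) := by
  refine ⟨h.1.after z, eq_of_sum_mul_le (f' := M.bestVal b g) (h.1.head a).1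
    (fun y => infVal_le_bestVal (b := b) (g := g) (h.1.after y)) ?_ hz⟩
  refine ha.trans ?_
  rw [← h.2]
  exact infVal_le_sum h.1 hg hb a

/-- From a state of `T` with maximal best value, the scheduler plays the action that stays in `T`.
All successors are then maximal too and their residual strategies remain optimal, so the process
never leaves `T` and never meets `g`. -/
theorem IMDP.Attains.bestVal_le_zero_of_trap {T : S → Prop} (hT : ∀ x, T x → ¬ g x)
    (htrap : ∀ x, T x → ∀ τ, M.Attains b g x τ → ∃ a, ∀ z, τ [] a z ≠ 0 → T z) {x : S}
    (hx : T x) (hmax : ∀ y, T y → M.bestVal b g y ≤ M.bestVal b g x)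
    {τ : List S → A → S → ℝ} (hτ : M.Attains b g x τ) : M.bestVal b g x ≤ 0 := by
  rw [← hτ.2]
  refine ciSup_le fun k => ?_
  induction k generalizing x τ with
  | zero => rw [minVal, maxVal_zero_of_not (hT x hx), neg_zero]
  | succ k ih =>
    by_cases hb : b x
    · obtain ⟨a, ha⟩ := htrap x hx τ hτ
      have hμ := (hτ.1.head a).1
      have hle : ∀ z, τ [] a z * M.bestVal b g z ≤ τ [] a z * M.bestVal b g x := by
        intro z
        by_cases hz : τ [] a z = 0
        · simp [hz]
        · exact mul_le_mul_of_nonneg_left (hmax z (ha z hz)) (hμ.1 z)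
      have hsum : ∑ z, τ [] a z * M.bestVal b g x = M.bestVal b g x := by
        rw [← Finset.sum_mul, hμ.2, one_mul]
      have hge := hτ.bestVal_le_sum (hT x hx) hb a
      have heq := (Finset.sum_eq_sum_iff_of_le fun z _ => hle z).1
        (le_antisymm (Finset.sum_le_sum fun z _ => hle z) (hsum.trans_le hge))
      refine (minVal_succ_le (hT x hx) hb a).trans (Finset.sum_nonpos fun z _ => ?_)
      by_cases hz : τ [] a z = 0
      · simp [hz]
      · have hzx : M.bestVal b g z = M.bestVal b g x :=
          mul_left_cancel₀ hz (heq z (Finset.mem_univ z))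
        refine mul_nonpos_of_nonneg_of_nonpos (hμ.1 z) (ih (ha z hz) (fun y hy => ?_) ?_)
        · rw [hzx]; exact hmax y hy
        · exact hτ.after (hT x hx) hb
            ((Finset.sum_le_sum fun z _ => hle z).trans hsum.le) hz
    · rw [minVal, maxVal_of_not (hT x hx) hb, neg_zero]

open scoped Classical in
/-- Play `ν` as long as the process stays in `H`, and switch to the strategy `τ z` in the first
state `z` outside `H`. -/
noncomputable def switchPlan {β : Type*} (H : S → Prop) (ν : S → β) (τ : S → List S → β) :
    List S → S → β
  | [], x => if H x then ν x else τ x []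
  | y :: l, x => if H x then switchPlan H ν τ l y else τ x (y :: l)

/-- A stationary strategy of nature that does not decrease the expectation of `f` on `H`
guarantees `f` if it cannot be trapped in `H`. -/
theorem exists_le_infVal_of_no_trap {H : S → Prop} {f : S → ℝ} {ν : S → A → S → ℝ}
    (hν : ∀ x, H x → ∀ a, ν x a ∈ M.feasible x a) (hH : ∀ x, H x → ¬ g x ∧ b x)
    (hstep : ∀ x, H x → ∀ a, f x ≤ ∑ y, ν x a y * f y)
    (hout : ∀ x, ¬ H x → ∃ τ, M.IsPlan x τ ∧ f x ≤ infVal b g x τ)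
    (htrap : ∀ T : S → Prop, (∃ x, T x) →
      (∀ x, T x → H x ∧ ∃ a, ∀ y, ν x a y ≠ 0 → T y) → False) (x : S) :
    ∃ τ, M.IsPlan x τ ∧ f x ≤ infVal b g x τ := by
  have hout' : ∀ x, ∃ τ, M.IsPlan x τ ∧ (¬ H x → f x ≤ infVal b g x τ) := by
    intro x
    by_cases hx : H x
    · obtain ⟨τ, hτ⟩ := M.exists_isPlan (A := A) x
      exact ⟨τ, hτ, fun h => absurd hx h⟩
    · obtain ⟨τ, hτ, h⟩ := hout x hx
      exact ⟨τ, hτ, fun _ => h⟩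
  choose τ hτ hf using hout'
  let π : S → List S → A → S → ℝ := fun x l => switchPlan H ν τ l x
  have hπH : ∀ x y, H x → after (π x) y = π y := by
    intro x y hx
    funext l
    simp [π, after, switchPlan, hx]
  have hπH0 : ∀ x, H x → π x [] = ν x := by
    intro x hx
    simp [π, switchPlan, hx]
  have hπout : ∀ x, ¬ H x → π x = τ x := by
    intro x hx
    funext l
    cases l <;> simp [π, switchPlan, hx]
  have hπ : ∀ x, M.IsPlan x (π x) := by
    intro x l
    induction l generalizing x with
    | nil =>
      intro a
      by_cases hx : H x
      · rw [hπH0 x hx]; exact hν x hx a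
      · rw [hπout x hx]; exact hτ x [] a
    | cons y l ih =>
      intro a
      by_cases hx : H x
      · rw [List.getLastD_cons]
        have := ih y a
        rwa [← hπH x y hx] at this
      · rw [hπout x hx]; exact hτ x (y :: l) a
  refine ⟨π x, hπ x, ?_⟩
  by_contra! hlt
  have : Nonempty S := ⟨x⟩
  obtain ⟨x₀, hx₀⟩ := Finite.exists_max fun y => f y - infVal b g y (π y)
  have hpos : 0 < f x₀ - infVal b g x₀ (π x₀) := lt_of_lt_of_le (by linarith) (hx₀ x)
  -- The states with the largest positive deficit form a trap: outside `H` there is no deficit, and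
  -- under a minimising action the expected deficit does not decrease, so all successors have
  -- maximal deficit.
  refine htrap (fun y => f y - infVal b g y (π y) = f x₀ - infVal b g x₀ (π x₀)) ⟨x₀, rfl⟩ ?_
  intro y hy
  have hyH : H y := by
    by_contra hyH
    have := hf y hyH
    rw [hπout y hyH] at hy
    linarith
  refine ⟨hyH, ?_⟩
  obtain ⟨a, ha⟩ := exists_sum_infVal_le (hπ y) (hH y hyH).1 (hH y hyH).2
  rw [hπH0 y hyH] at ha
  simp only [hπH y _ hyH] at ha
  refine ⟨a, fun z hz => ?_⟩
  refine eq_of_sum_mul_le (f := fun z => f z - infVal b g z (π z)) (hν y hyH a).1 hx₀ ?_ hz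
  rw [← Finset.sum_mul, (hν y hyH a).1.2, one_mul, ← hy]
  simp only [mul_sub, Finset.sum_sub_distrib]
  linarith [hstep y hyH a]

/-- Here the order-connectedness of the transition constraints enters. -/
theorem convex_feasible (M : IMDP S A AP) (x : S) (a : A) : Convex ℝ (M.feasible x a) := by
  have h : M.feasible x a = stdSimplex ℝ S ∩ Set.pi Set.univ (M.interval x a) := by
    ext μ; simp [IMDP.feasible]
  rw [h]
  exact (convex_stdSimplex ℝ S).inter
    (convex_pi fun s' _ => (M.interval_ordConnected x a s').convex)

/-- The uniform average keeps common lower bounds on expectations, and its support contains each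
support, so it escapes every set that some `ν i` escapes. -/
theorem exists_average {ι : Type*} [Finite ι] [Nonempty ι] {x : S} {a : A} {ν : ι → S → ℝ}
    (hν : ∀ i, ν i ∈ M.feasible x a) :
    ∃ μ ∈ M.feasible x a, (∀ (f : S → ℝ) (r : ℝ), (∀ i, r ≤ ∑ y, ν i y * f y) →
      r ≤ ∑ y, μ y * f y) ∧ ∀ i z, ν i z ≠ 0 → μ z ≠ 0 := by
  classical
  have := Fintype.ofFinite ι
  have hc : (0 : ℝ) < (Fintype.card ι : ℝ)⁻¹ := by
    have : (0 : ℝ) < Fintype.card ι := by exact_mod_cast Fintype.card_pos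
    positivity
  have hsum : ∑ _i : ι, (Fintype.card ι : ℝ)⁻¹ = 1 := by
    rw [Finset.sum_const, Finset.card_univ, nsmul_eq_mul, mul_inv_cancel₀]
    exact_mod_cast Fintype.card_ne_zero
  have happ : ∀ y, (∑ i, (Fintype.card ι : ℝ)⁻¹ • ν i) y =
      ∑ i, (Fintype.card ι : ℝ)⁻¹ * ν i y := by
    intro y; simp
  refine ⟨∑ i, (Fintype.card ι : ℝ)⁻¹ • ν i,
    (convex_feasible M x a).sum_mem (fun _ _ => hc.le) hsum fun i _ => hν i, ?_, ?_⟩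
  · intro f r hr
    simp only [happ, Finset.sum_mul]
    rw [Finset.sum_comm]
    calc r = ∑ _i : ι, (Fintype.card ι : ℝ)⁻¹ * r := by rw [← Finset.sum_mul, hsum, one_mul]
      _ ≤ ∑ i, (Fintype.card ι : ℝ)⁻¹ * ∑ y, ν i y * f y :=
        Finset.sum_le_sum fun i _ => mul_le_mul_of_nonneg_left (hr i) hc.le
      _ = _ := by simp only [Finset.mul_sum, mul_assoc]
  · intro i z hz
    rw [happ]
    refine ne_of_gt (Finset.sum_pos' (fun j _ => mul_nonneg hc.le ((hν j).1.1 z))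
      ⟨i, Finset.mem_univ i, mul_pos hc (lt_of_le_of_ne ((hν i).1.1 z) hz.symm)⟩)

variable {R : S → S → Prop}

/-- The best value is a supremum over both strategies and horizons, so imitation at each finite
horizon suffices, even with strategies depending on the horizon. -/
theorem IMDP.IsBisimulation.bestVal_le (h : M.IsBisimulation R) (hb : Saturated R b)
    (hg : Saturated R g) {s t : S} (hst : Quot.mk R s = Quot.mk R t) :
    M.bestVal b g s ≤ M.bestVal b g t := by
  refine ciSup_le fun τ => ciSup_le fun k => ?_
  obtain ⟨τ', hτ', hle⟩ := h.exists_minVal_ge hb hg k hst τ.2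
  exact hle.trans ((minVal_le_infVal hτ' k).trans (infVal_le_bestVal hτ'))

theorem IMDP.IsBisimulation.bestVal_eq (h : M.IsBisimulation R) (hb : Saturated R b)
    (hg : Saturated R g) {s t : S} (hst : Quot.mk R s = Quot.mk R t) :
    M.bestVal b g s = M.bestVal b g t :=
  le_antisymm (h.bestVal_le hb hg hst) (h.bestVal_le hb hg hst.symm)

/-- If all the mass of one action of the simulating family lies in a union of classes, then so
does all the mass of some action of the simulated family. -/
theorem Simulates.exists_supported {ν μ : A → S → ℝ} (h : Simulates R ν μ)
    (hμ : ∀ a, μ a ∈ stdSimplex ℝ S) {T : Quot R → Prop} {a : A}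
    (ha : ∀ z, ν a z ≠ 0 → T (Quot.mk R z)) :
    ∃ a', ∀ z, μ a' z ≠ 0 → T (Quot.mk R z) := by
  classical
  obtain ⟨ρ, hρ, e⟩ := h _ (single_mem_stdSimplex ℝ a)
  rw [mix_single] at e
  -- Testing against the indicator of the complement of `T` shows that the matching mixture puts no
  -- mass there, and hence neither does any action of positive weight.
  have e := e fun C => if T C then 0 else 1
  have h0 : ∑ y, ν a y * (if T (Quot.mk R y) then (0 : ℝ) else 1) = 0 := by
    refine Finset.sum_eq_zero fun y _ => ?_
    by_cases hy : ν a y = 0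
    · simp [hy]
    · simp [ha y hy]
  rw [h0] at e
  have hmix := mix_mem hρ hμ
  have hz := (Finset.sum_eq_zero_iff_of_nonneg fun y _ =>
    mul_nonneg (hmix.1 y) (by split_ifs <;> norm_num)).1 e.symm
  obtain ⟨a', ha'⟩ : ∃ a', ρ a' ≠ 0 := by
    by_contra! h0
    have := hρ.2
    simp [h0] at this
  refine ⟨a', fun z hz' => ?_⟩
  by_contra hT
  have h1 := hz z (Finset.mem_univ z)
  rw [if_neg hT, mul_one, mix] at h1
  have h2 := (Finset.sum_eq_zero_iff_of_nonneg fun a _ =>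
    mul_nonneg (hρ.1 a) ((hμ a).1 z)).1 h1 a' (Finset.mem_univ a')
  exact (mul_ne_zero ha' hz') h2

/-- Whether nature can attain its best value only depends on the bisimulation class. -/
theorem IMDP.IsBisimulation.exists_bestVal_le_infVal (h : M.IsBisimulation R)
    (hb : Saturated R b) (hg : Saturated R g) {s t : S} (hst : Quot.mk R s = Quot.mk R t)
    {τ : List S → A → S → ℝ} (hτ : M.Attains b g s τ) :
    ∃ τ', M.IsPlan t τ' ∧ M.bestVal b g t ≤ infVal b g t τ' := by
  classical
  let G : Quot R → Prop := fun C => ∃ y, Quot.mk R y = C ∧ ∃ τ, M.Attains b g y τ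
  let H : S → Prop := fun x => G (Quot.mk R x) ∧ ¬ g x ∧ b x ∧ 0 < M.bestVal b g x
  have hHsat : ∀ x y, Quot.mk R x = Quot.mk R y → H x → H y := by
    rintro x y hxy ⟨h1, h2, h3, h4⟩
    exact ⟨hxy ▸ h1, mt (hg x y hxy).2 h2, (hb x y hxy).1 h3, h.bestVal_eq hb hg hxy ▸ h4⟩
  -- For an attaining state and a set of classes, choose an optimal strategy whose first move cannot
  -- be confined to that set, if there is one. Being confined therefore means that all optimal
  -- strategies are.
  have Hσ : ∀ i : {y // ∃ τ, M.Attains b g y τ} × (Quot R → Prop), ∃ σ, M.Attains b g i.1.1 σ ∧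
      ((∃ a, ∀ z, σ [] a z ≠ 0 → i.2 (Quot.mk R z)) →
        ∀ σ', M.Attains b g i.1.1 σ' → ∃ a, ∀ z, σ' [] a z ≠ 0 → i.2 (Quot.mk R z)) := by
    rintro ⟨⟨y, τ, hτ⟩, T⟩
    by_cases hc : ∀ σ', M.Attains b g y σ' → ∃ a, ∀ z, σ' [] a z ≠ 0 → T (Quot.mk R z)
    · exact ⟨τ, hτ, fun _ => hc⟩
    · push Not at hc
      obtain ⟨σ, hσ, hn⟩ := hc
      refine ⟨σ, hσ, fun ⟨a, ha⟩ => ?_⟩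
      obtain ⟨z, hz, hz'⟩ := hn a
      exact absurd (ha z hz) hz'
  choose σ hσ hσtrap using Hσ
  have hGt : ∀ y : {y // ∃ τ, M.Attains b g y τ}, G (Quot.mk R y.1) := fun y => ⟨y.1, rfl, y.2⟩
  -- Outside `G` the target is lowered by `ε`, so that it lies strictly below the supremum and some
  -- strategy reaches it.
  let f : ℝ → Quot R → ℝ := fun ε C =>
    Quot.lift (fun x => M.bestVal b g x)
      (fun x y hxy => h.bestVal_eq hb hg (Quot.sound hxy)) C - if G C then 0 else ε
  have hε : ∃ ε > 0, ∀ (i : {y // ∃ τ, M.Attains b g y τ} × (Quot R → Prop)) (a : A),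
      H i.1.1 → M.bestVal b g i.1.1 ≤ ∑ z, σ i [] a z * f ε (Quot.mk R z) := by
    have hev : ∀ᶠ ε in 𝓝[>] (0 : ℝ),
        ∀ (i : {y // ∃ τ, M.Attains b g y τ} × (Quot R → Prop)) (a : A),
        H i.1.1 → M.bestVal b g i.1.1 ≤ ∑ z, σ i [] a z * f ε (Quot.mk R z) := by
      refine eventually_all.2 fun i => eventually_all.2 fun a => ?_
      by_cases hH : H i.1.1
      swap
      · exact Eventually.of_forall fun _ h => absurd h hH
      -- A strict inequality survives a small penalty. Equality makes the residual strategies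
      -- optimal at all successors, which then lie in `G` and incur no penalty. There are finitely
      -- many pairs `(i, a)`, so one `ε` works for all.
      rcases ((hσ i).bestVal_le_sum hH.2.1 hH.2.2.1 a).lt_or_eq with hlt | heq
      · have hcont : Continuous fun ε : ℝ => ∑ z, σ i [] a z * f ε (Quot.mk R z) := by
          refine continuous_finsetSum _ fun z _ => continuous_const.mul ?_
          by_cases hz : G (Quot.mk R z)
          · simp only [f, hz, if_true]; fun_prop
          · simp only [f, hz, if_false]; fun_prop
        have h0 : ∑ z, σ i [] a z * f 0 (Quot.mk R z) = ∑ z, σ i [] a z * M.bestVal b g z := by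
          simp [f]
        have := ((hcont.tendsto 0).mono_left
          (nhdsWithin_le_nhds (s := Set.Ioi 0))).eventually_const_lt (h0 ▸ hlt)
        exact this.mono fun ε h _ => h.le
      · refine Eventually.of_forall fun ε _ => ?_
        rw [heq]
        refine (Finset.sum_congr rfl fun z _ => ?_).le
        by_cases hz : σ i [] a z = 0
        · simp [hz]
        · have : G (Quot.mk R z) := ⟨z, rfl, _, (hσ i).after hH.2.1 hH.2.2.1 heq.ge hz⟩
          simp [f, this]
    obtain ⟨ε, h1, h2⟩ := (hev.and self_mem_nhdsWithin).exists
    exact ⟨ε, h2, h1⟩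
  obtain ⟨ε, hε0, hε⟩ := hε
  have hfG : ∀ x, G (Quot.mk R x) → f ε (Quot.mk R x) = M.bestVal b g x := by
    intro x hx; simp [f, hx]
  have hsim : ∀ (x : S) (i : {i : {y // ∃ τ, M.Attains b g y τ} × (Quot R → Prop) //
      Quot.mk R i.1.1 = Quot.mk R x}), ∃ ν : A → S → ℝ, (∀ a, ν a ∈ M.feasible x a) ∧
      Simulates R ν (σ i.1 []) := fun x i => h.exists_simulates i.2 (hσ i.1).1.head
  choose ν₀ hν₀ hsim using hsim
  -- The stationary move at `x` averages the replies to all chosen optimal first moves in the class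
  -- of `x`; this family is nonempty when `H x` holds.
  have hν : ∀ (x : S) (a : A), ∃ μ : S → ℝ, H x → μ ∈ M.feasible x a ∧
      (∀ (f : S → ℝ) (r : ℝ), (∀ i, r ≤ ∑ y, ν₀ x i a y * f y) → r ≤ ∑ y, μ y * f y) ∧
      ∀ i z, ν₀ x i a z ≠ 0 → μ z ≠ 0 := by
    intro x a
    by_cases hx : H x
    · obtain ⟨y, hy, hy'⟩ := hx.1
      have : Nonempty {i : {y // ∃ τ, M.Attains b g y τ} × (Quot R → Prop) //
        Quot.mk R i.1.1 = Quot.mk R x} := ⟨⟨(⟨y, hy'⟩, fun _ => True), hy⟩⟩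
      obtain ⟨μ, h1, h2, h3⟩ := exists_average fun i => hν₀ x i a
      exact ⟨μ, fun _ => ⟨h1, h2, h3⟩⟩
    · exact ⟨0, fun h => absurd h hx⟩
  choose ν hν using hν
  have hGs : G (Quot.mk R t) := ⟨s, hst, τ, hτ⟩
  have main := exists_le_infVal_of_no_trap (M := M) (b := b) (g := g) (H := H)
    (f := fun x => f ε (Quot.mk R x)) (ν := ν) (fun x hx a => (hν x a hx).1)
    (fun x hx => ⟨hx.2.1, hx.2.2.1⟩) ?_ ?_ ?_ t
  · obtain ⟨τ', hτ', hle⟩ := main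
    exact ⟨τ', hτ', (hfG t hGs).symm.trans_le hle⟩
  · intro x hx a
    refine (hν x a hx).2.1 _ _ fun i => ?_
    obtain ⟨ρ, hρ, e⟩ := hsim x i _ (single_mem_stdSimplex ℝ a)
    rw [mix_single] at e
    rw [e, sum_mix_mul, hfG x hx.1, ← h.bestVal_eq hb hg i.2]
    have hi : H i.1.1.1 := hHsat _ _ i.2.symm hx
    calc M.bestVal b g i.1.1.1 = ∑ a, ρ a * M.bestVal b g i.1.1.1 := by
          rw [← Finset.sum_mul, hρ.2, one_mul]
      _ ≤ _ := sum_mul_mono hρ fun a => hε i.1 a hi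
  · intro x hx
    by_cases hGx : G (Quot.mk R x)
    · obtain ⟨τ', hτ'⟩ := M.exists_isPlan (A := A) x
      refine ⟨τ', hτ', ?_⟩
      rw [hfG x hGx]
      by_cases hgx : g x
      · rw [infVal_of_goal hgx]; exact bestVal_le_one x
      by_cases hbx : b x
      · have : ¬ 0 < M.bestVal b g x := fun h0 => hx ⟨hGx, hgx, hbx, h0⟩
        exact (not_lt.1 this).trans (infVal_mem hτ').1
      · rw [infVal_of_not hgx hbx]
        exact ciSup_le fun τ => (infVal_of_not hgx hbx).le
    · have : f ε (Quot.mk R x) = M.bestVal b g x - ε := by simp [f, hGx]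
      obtain ⟨τ', hτ', hlt⟩ := exists_lt_infVal (M := M) (b := b) (g := g) (x := x)
        (r := f ε (Quot.mk R x)) (by rw [this]; linarith)
      exact ⟨τ', hτ', hlt.le⟩
  · rintro T ⟨x₀, hx₀⟩ hT
    let T' : Quot R → Prop := fun C => ∃ x, T x ∧ Quot.mk R x = C
    have hT'H : ∀ y, T' (Quot.mk R y) → H y := by
      rintro y ⟨x, hx, hxy⟩
      exact hHsat x y hxy (hT x hx).1
    obtain ⟨x₁, hx₁, hmax⟩ := (Finset.univ.filter fun y => T' (Quot.mk R y)).exists_max_image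
      (M.bestVal b g) ⟨x₀, by simpa using ⟨x₀, hx₀, rfl⟩⟩
    simp only [Finset.mem_filter, Finset.mem_univ, true_and] at hx₁ hmax
    -- The maximiser `x₁` need not attain its best value, but some state of its class does, with the
    -- same best value.
    obtain ⟨y, hy, σ', hσ'⟩ := (hT'H x₁ hx₁).1
    have hyT : T' (Quot.mk R y) := hy ▸ hx₁
    refine absurd (IMDP.Attains.bestVal_le_zero_of_trap (T := fun y => T' (Quot.mk R y))
      (fun x hx => (hT'H x hx).2.1) ?_ hyT ?_ hσ') (not_le.2 (hT'H y hyT).2.2.2)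
    · rintro z ⟨x, hx, hxz⟩ σ'' hσ''
      obtain ⟨hxH, a, ha⟩ := hT x hx
      -- A trap for the average traps the reply to the strategy selected for `z` and `T'`, hence
      -- that strategy, hence by its choice every optimal strategy at `z`.
      let i : {i : {y // ∃ τ, M.Attains b g y τ} × (Quot R → Prop) //
        Quot.mk R i.1.1 = Quot.mk R x} := ⟨(⟨z, σ'', hσ''⟩, T'), hxz.symm⟩
      refine hσtrap i.1 ?_ σ'' hσ''
      refine (hsim x i).exists_supported
        (fun a => ((hσ i.1).1.head a).1) (a := a) fun w hw => ?_
      exact ⟨w, ha w ((hν x a hxH).2.2 i w hw), rfl⟩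
    · intro w hw
      rw [h.bestVal_eq hb hg hy]
      exact hmax w hw

/-- Below the common best value of the class, the definition of the supremum gives a strategy at
`t`; only equality needs the attainment result. -/
theorem IMDP.IsBisimulation.exists_infVal_ge (h : M.IsBisimulation R)
    (hb : Saturated R b) (hg : Saturated R g) {s t : S} (hst : Quot.mk R s = Quot.mk R t)
    {τ : List S → A → S → ℝ} (hτ : M.IsPlan s τ) :
    ∃ τ', M.IsPlan t τ' ∧ infVal b g s τ ≤ infVal b g t τ' := by
  rcases (infVal_le_bestVal (b := b) (g := g) hτ).lt_or_eq with hlt | heq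
  · obtain ⟨τ', hτ', hlt'⟩ := exists_lt_infVal (hlt.trans_eq (h.bestVal_eq hb hg hst))
    exact ⟨τ', hτ', hlt'.le⟩
  · obtain ⟨τ', hτ', hle⟩ := h.exists_bestVal_le_infVal hb hg hst ⟨hτ, heq⟩
    exact ⟨τ', hτ', (heq.trans (h.bestVal_eq hb hg hst)).trans_le hle⟩

end Attainment

/-! ### Transfer of enforceable bounds and induction on formulas -/

section Transfer

variable {S A AP : Type*} [Fintype S] [Fintype A] {M : IMDP S A AP} {b g : S → Prop}
  {R : S → S → Prop} {s t : S}

/-- Nature has a strategy from `x` such that the value `v` of the strategies of the scheduler and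
of nature compares to `p` for all strategies of the scheduler. -/
def IMDP.Forces (M : IMDP S A AP) (c : Comparison) (p : ℝ) (x : S)
    (v : (List S → A → ℝ) → (List S → A → S → ℝ) → ℝ) : Prop :=
  ∃ τ, M.IsPlan x τ ∧ ∀ σ, IsSched σ → c.holds (v σ τ) p

/-- Without actions there is no distribution on `A`, hence no scheduler to test. -/
theorem IMDP.forces_of_isEmpty [IsEmpty A] (M : IMDP S A AP) (c : Comparison) (p : ℝ) (x : S)
    (v : (List S → A → ℝ) → (List S → A → S → ℝ) → ℝ) : M.Forces c p x v := by
  obtain ⟨τ, hτ⟩ := M.exists_isPlan (A := A) x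
  refine ⟨τ, hτ, fun σ hσ => ?_⟩
  have := (hσ []).2
  simp at this

theorem IMDP.IsBisimulation.forces_untilProb (h : M.IsBisimulation R)
    (hb : Saturated R b) (hg : Saturated R g) (hst : Quot.mk R s = Quot.mk R t) (k : ℕ)
    (c : Comparison) {p : ℝ} (hs : M.Forces c p s (untilProb b g k s)) :
    M.Forces c p t (untilProb b g k t) := by
  rcases isEmpty_or_nonempty A with hA | hA
  · exact M.forces_of_isEmpty c p t _
  obtain ⟨τ, hτ, H⟩ := hs
  obtain ⟨σ₁, hσ₁, e₁⟩ := exists_untilProb_eq_maxVal b g k s τ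
  obtain ⟨σ₂, hσ₂, e₂⟩ := exists_untilProb_eq_minVal b g k s τ
  obtain ⟨τ₁, hτ₁, h₁⟩ := h.exists_maxVal_le hb hg 1 k hst hτ
  obtain ⟨τ₂, hτ₂, h₂⟩ := h.exists_minVal_ge hb hg k hst hτ
  have k₁ := H σ₁ hσ₁
  have k₂ := H σ₂ hσ₂
  rw [e₁] at k₁
  rw [e₂] at k₂
  cases c with
  | le => exact ⟨τ₁, hτ₁, fun σ hσ => (untilProb_le_maxVal k hσ hτ₁).trans (h₁.trans k₁)⟩
  | lt => exact ⟨τ₁, hτ₁, fun σ hσ => (untilProb_le_maxVal k hσ hτ₁).trans_lt (h₁.trans_lt k₁)⟩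
  | ge => exact ⟨τ₂, hτ₂, fun σ hσ => le_trans k₂ (h₂.trans (minVal_le_untilProb k hσ hτ₂))⟩
  | gt => exact ⟨τ₂, hτ₂, fun σ hσ => lt_of_lt_of_le k₂
      (h₂.trans (minVal_le_untilProb k hσ hτ₂))⟩

theorem IMDP.IsBisimulation.forces_iSup_untilProb (h : M.IsBisimulation R)
    (hb : Saturated R b) (hg : Saturated R g) (hst : Quot.mk R s = Quot.mk R t)
    (c : Comparison) {p : ℝ} (hs : M.Forces c p s fun σ τ => ⨆ k, untilProb b g k s σ τ) :
    M.Forces c p t fun σ τ => ⨆ k, untilProb b g k t σ τ := by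
  rcases isEmpty_or_nonempty A with hA | hA
  · exact M.forces_of_isEmpty c p t _
  have hsup : ∀ {x : S} {σ : List S → A → ℝ} {τ : List S → A → S → ℝ}, IsSched σ → M.IsPlan x τ →
      ⨆ k, untilProb b g k x σ τ ≤ supVal b g x τ := fun hσ hτ =>
    ciSup_le fun k => (untilProb_le_maxVal k hσ hτ).trans (maxVal_le_supVal hτ k)
  have hle : ∀ {x : S} {σ : List S → A → ℝ} {τ : List S → A → S → ℝ} (k : ℕ), IsSched σ →
      M.IsPlan x τ → untilProb b g k x σ τ ≤ ⨆ k, untilProb b g k x σ τ := fun k hσ hτ =>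
    le_ciSup (bddAbove_untilProb (b := b) (g := g) hσ hτ) k
  have hinf : ∀ {x : S} {σ : List S → A → ℝ} {τ : List S → A → S → ℝ}, IsSched σ → M.IsPlan x τ →
      infVal b g x τ ≤ ⨆ k, untilProb b g k x σ τ := fun hσ hτ =>
    ciSup_le fun k => (minVal_le_untilProb k hσ hτ).trans (hle k hσ hτ)
  obtain ⟨τ, hτ, H⟩ := hs
  obtain ⟨σ₀, hσ₀, hmin⟩ := exists_untilProb_le_infVal (b := b) (g := g) hτ
  have hmin : ⨆ k, untilProb b g k s σ₀ τ ≤ infVal b g s τ := ciSup_le hmin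
  cases c with
  | le =>
    obtain ⟨τ', hτ', h'⟩ := h.exists_supVal_le hb hg hst hτ
    refine ⟨τ', hτ', fun σ hσ => (hsup hσ hτ').trans (h'.trans (ciSup_le fun k => ?_))⟩
    obtain ⟨σ₁, hσ₁, e₁⟩ := exists_untilProb_eq_maxVal b g k s τ
    exact e₁ ▸ (hle k hσ₁ hτ).trans (H σ₁ hσ₁)
  | lt =>
    -- The supremum for `τ` itself may equal `p`, so `τ` is replaced by a strategy with a strict
    -- gap, which exists because no scheduler reaches `p` against `τ`.
    obtain ⟨τ₁, hτ₁, hlt⟩ : ∃ τ, M.IsPlan s τ ∧ supVal b g s τ < p := by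
      by_contra! hcon
      obtain ⟨σ, hσ, hσp⟩ := exists_sched_forall_ge M b g s hcon
      exact absurd (H σ hσ) (not_lt.2 (hσp τ hτ))
    obtain ⟨τ', hτ', h'⟩ := h.exists_supVal_le hb hg hst hτ₁
    exact ⟨τ', hτ', fun σ hσ => (hsup hσ hτ').trans_lt (h'.trans_lt hlt)⟩
  | ge =>
    obtain ⟨τ', hτ', h'⟩ := h.exists_infVal_ge hb hg hst hτ
    exact ⟨τ', hτ', fun σ hσ => le_trans (H σ₀ hσ₀) (hmin.trans (h'.trans (hinf hσ hτ')))⟩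
  | gt =>
    obtain ⟨τ', hτ', h'⟩ := h.exists_infVal_ge hb hg hst hτ
    exact ⟨τ', hτ', fun σ hσ => lt_of_lt_of_le (H σ₀ hσ₀) (hmin.trans (h'.trans (hinf hσ hτ')))⟩

theorem IMDP.IsBisimulation.forces_next [DecidablePred g] (h : M.IsBisimulation R)
    (hg : Saturated R g) (hst : Quot.mk R s = Quot.mk R t) (c : Comparison) {p : ℝ}
    (hs : M.Forces c p s fun σ τ => ∑ y, mix (σ []) (τ []) y * if g y then 1 else 0) :
    M.Forces c p t fun σ τ => ∑ y, mix (σ []) (τ []) y * if g y then 1 else 0 := by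
  obtain ⟨τ, hτ, H⟩ := hs
  obtain ⟨ν, hν, hsim⟩ := h.exists_simulates hst hτ.head
  choose τ' hτ' using M.exists_isPlan (A := A)
  refine ⟨consPlan ν τ', M.isPlan_consPlan hν hτ', fun σ hσ => ?_⟩
  obtain ⟨ρ, hρ, e⟩ := hsim _ (hσ [])
  have e' := e fun C => Quot.lift (fun y => if g y then (1 : ℝ) else 0)
    (fun x y hxy => if_congr (hg x y (Quot.sound hxy)) rfl rfl) C
  change c.holds (∑ y, mix (σ []) ν y * if g y then 1 else 0) p
  rw [show ∑ y, mix (σ []) ν y * (if g y then (1 : ℝ) else 0) = _ from e']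
  -- Only the first decision `ρ` matters; `σ` merely fills in the later ones.
  exact H (consPlan ρ fun _ => σ) (isSched_consPlan hρ fun _ => hσ)

variable [MeasurableSpace S] [DiscreteMeasurableSpace S]

/-- The probability depends on the strategies only through their residuals from `x`, and every list
strategy is such a residual. -/
theorem exists_nature_iff_forces (E : Set (ℕ → S)) (c : Comparison) (p : ℝ)
    (v : S → (List S → A → ℝ) → (List S → A → S → ℝ) → ℝ)
    (hv : ∀ (σ : Scheduler S A) (π : Nature M) (x : S),
      (pathMeasure σ π x).real E = v x (σ.residual x) (π.residual x)) (x : S) :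
    (∃ π : Nature M, ∀ σ : Scheduler S A, c.holds ((pathMeasure σ π x).real E) p) ↔
      M.Forces c p x (v x) := by
  constructor
  · rintro ⟨π, H⟩
    refine ⟨π.residual x, π.isPlan_residual x, fun σ hσ => ?_⟩
    obtain ⟨σ', rfl⟩ := Scheduler.exists_residual_eq hσ x
    rw [← hv]
    exact H σ'
  · rintro ⟨τ, hτ, H⟩
    obtain ⟨π, rfl⟩ := Nature.exists_residual_eq hτ
    refine ⟨π, fun σ => ?_⟩
    rw [hv]
    exact H _ (σ.isSched_residual x)

/-- Bisimilar states satisfy the same state formulas, and the same probabilistic constraints on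
path formulas. -/
theorem IMDP.IsBisimulation.sat_invariant (h : M.IsBisimulation R)
    {k : FormulaSort} (φ : Formula AP k) :
    match k, φ with
    | .state, φ => Saturated R fun x => M.Sat φ x
    | .path, ψ => ∀ c p, Saturated R fun x => M.Sat (.prob c p ψ) x := by
  classical
  have symm : ∀ {P : S → Prop}, (∀ x y, Quot.mk R x = Quot.mk R y → P x → P y) →
      Saturated R P := fun hP x y hxy => ⟨hP x y hxy, hP y x hxy.symm⟩
  induction φ with
  | tt => exact fun _ _ _ => Iff.rfl
  | atom x =>
    intro s t hst
    have : M.label s = M.label t := by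
      have := Quot.eqvGen_exact hst
      induction this with
      | rel s t hr => exact h.label_eq s t hr
      | refl => rfl
      | symm s t h1 ih => exact (ih (Quot.eqvGen_sound h1)).symm
      | trans s t u h1 h2 ih1 ih2 =>
        exact (ih1 (Quot.eqvGen_sound h1)).trans (ih2 (Quot.eqvGen_sound h2))
    simp only [IMDP.Sat, this]
  | neg φ ih => exact fun s t hst => not_congr (ih s t hst)
  | conj φ₁ φ₂ ih₁ ih₂ => exact fun s t hst => and_congr (ih₁ s t hst) (ih₂ s t hst)
  | prob c p ψ ih => exact ih c p
  | next φ ih =>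
    refine fun c p => symm fun s t hst hs => ?_
    have key := exists_nature_iff_forces (M := M) _ c (p : ℚ)
      (fun _ σ τ => ∑ y, mix (σ []) (τ []) y * if M.Sat φ y then 1 else 0) fun σ π x =>
      pathMeasure_real_next (fun y => M.Sat φ y) σ π x
    exact (key t).2 (h.forces_next ih hst c ((key s).1 hs))
  | untl φ₁ φ₂ ih₁ ih₂ =>
    refine fun c p => symm fun s t hst hs => ?_
    have key := exists_nature_iff_forces (M := M) _ c (p : ℚ)
      (fun x σ τ => ⨆ k, untilProb (fun y => M.Sat φ₁ y) (fun y => M.Sat φ₂ y) k x σ τ)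
      fun σ π x => pathMeasure_real_until (fun y => M.Sat φ₁ y) (fun y => M.Sat φ₂ y) σ π x
    exact (key t).2 (h.forces_iSup_untilProb ih₁ ih₂ hst c ((key s).1 hs))
  | untlLe k φ₁ φ₂ ih₁ ih₂ =>
    refine fun c p => symm fun s t hst hs => ?_
    have key := exists_nature_iff_forces (M := M) _ c (p : ℚ) _ fun σ π x =>
      pathMeasure_real_untilLe (fun y => M.Sat φ₁ y) (fun y => M.Sat φ₂ y) σ π x k
    exact (key t).2 (h.forces_untilProb ih₁ ih₂ hst k c ((key s).1 hs))

end Transfer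

end IntervalMDP

theorem mainTheorem3 {S A AP : Type*} [Fintype S] [Fintype A]
    [MeasurableSpace S] [DiscreteMeasurableSpace S]
    (M : IntervalMDP.IMDP S A AP) (s t : S) (hst : M.Bisimilar s t)
    (φ : IntervalMDP.StateFormula AP) :
    M.Sat φ s ↔ M.Sat φ t := by
  obtain ⟨R, h, hR⟩ := hst
  exact h.sat_invariant φ s t (Quot.sound hR)
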